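/- Let $I=[-\tfrac12,\tfrac12]$ and let $f\colon I\setminus\{0\}\to I$ be a $C^2$ map (with one-sided derivatives at $\pm\tfrac12$) such that (f1) $\lim_{x\to0^-}f(x)=\tfrac12$ and $\lim_{x\to0^+}f(x)=-\tfrac12$; (f2) $f'(x)>\sqrt2$ for all $x\in I\setminus\{0\}$; (f3) $\lim_{x\to0^-}f'(x)=\lim_{x\to0^+}f'(x)=+\infty$; and $f(-\tfrac12)\ne-\tfrac12$, $f(\tfrac12)\ne\tfrac12$. Suppose moreover that there are a real number $\alpha$ and constants $C,C_1>1$ such that for all $x\in I\setminus\{0\}$ $$\frac1C\le\frac{f'(x)}{|x|^{\alpha-1}}\le C\qquad\text{and}\qquad\frac{|f''(x)|}{|x|^{\alpha-2}}\le C_1 .$$ Then there is an increasing family $K_0\subseteq K_1\subseteq K_2\subseteq\cdots$ of regular Cantor sets $K_k$ for $f$ such that the Hausdorff dimensions satisfy $HD(K_k)\to1$ as $k\to+\infty$. Here a regular Cantor set is a Cantor set $K\subset\mathbb R$ (nonempty, compact, perfect, totally disconnected) for which there are pairwise disjoint nondegenerate compact intervals $I_1,\dots,I_r$ and a map $\psi$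 of class $C^{1+\varepsilon}$ (for some $0<\varepsilon\le1$) and expanding ($|\psi'|\ge\sigma$ for some $\sigma>1$) on a neighbourhood of $I_1\cup\dots\cup I_r$ such that: $K\subset I_1\cup\dots\cup I_r$ and $\partial I_j\subset K$ for every $j$; each $\psi(I_j)$ is the convex hull of the union of some (at least one) of the $I_s$; for each $j$, $\psi^n(K\cap I_j)=K$ for all sufficiently large $n$; and $K=\bigcap_{n\ge0}\psi^{-n}(I_1\cup\dots\cup I_r)$. It is a regular Cantor set for $f$ if $\psi$ can be chosen so that for each $j$ there is $m_j\ge1$ for which $f^{m_j}$ is defined on $I_j$ (that is, $f^i(I_j)\subset I\setminus\{0\}$ for $0\le i<m_j$) and $\psi=f^{m_j}$ on $I_j$. -/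

import Mathlib

open Set Filter Topology
open scoped NNReal

/-- The punctured interval `[-1/2, 1/2] ∖ {0}`, the domain of the one-dimensional Lorenz map. -/
def puncturedInterval : Set ℝ := Icc (-1 / 2 : ℝ) (1 / 2) \ {0}

/-- A Cantor set in the real line: a nonempty, compact, perfect, totally disconnected set. -/
structure IsCantorSet (K : Set ℝ) : Prop where
  nonempty : K.Nonempty
  isCompact : IsCompact K
  perfect : Perfect K
  totallyDisconnected : IsTotallyDisconnected K

/-- `ψ` is a `C^{1+ε}` expanding map, for some Hölder exponent `0 < ε ≤ 1`, on some open
neighbourhood `U` of `A`. -/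
def IsHolderExpandingNear (ψ : ℝ → ℝ) (A : Set ℝ) : Prop :=
  ∃ U : Set ℝ, IsOpen U ∧ A ⊆ U ∧ ContDiffOn ℝ 1 ψ U ∧
    (∃ ε : ℝ≥0, 0 < ε ∧ ε ≤ 1 ∧ ∃ M : ℝ≥0, HolderOnWith M ε (deriv ψ) U) ∧
    (∃ σ : ℝ, 1 < σ ∧ ∀ x ∈ U, σ ≤ |deriv ψ x|)

/-- `K` is a regular (dynamically defined) Cantor set, defined by the map `ψ`, with Markov
partition formed by the compact intervals `[a j, b j]`, `j = 1, …, r`. Only the values of `ψ`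
near the union of these intervals matter: since `n = 0` is included in `eq_maximal`, that clause
describes the points whose whole `ψ`-orbit stays in the union of the intervals. -/
structure IsRegularCantorSet (K : Set ℝ) {r : ℕ} (a b : Fin r → ℝ) (ψ : ℝ → ℝ) : Prop where
  isCantor : IsCantorSet K
  lt : ∀ j, a j < b j
  disjoint : Pairwise fun i j => Disjoint (Icc (a i) (b i)) (Icc (a j) (b j))
  subset : K ⊆ ⋃ j, Icc (a j) (b j)
  left_mem : ∀ j, a j ∈ K
  right_mem : ∀ j, b j ∈ K
  expanding : IsHolderExpandingNear ψ (⋃ j, Icc (a j) (b j))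
  markov : ∀ j, ∃ S : Finset (Fin r), S.Nonempty ∧
    ψ '' Icc (a j) (b j) = convexHull ℝ (⋃ s ∈ S, Icc (a s) (b s))
  mixing : ∀ j, ∀ᶠ n : ℕ in atTop, ψ^[n] '' (K ∩ Icc (a j) (b j)) = K
  eq_maximal : K = ⋂ n : ℕ, ψ^[n] ⁻¹' (⋃ j, Icc (a j) (b j))

/-- `K` is a regular Cantor set for the map `f : [-1/2, 1/2] ∖ {0} → [-1/2, 1/2]`: it is a regular
Cantor set defined by a map whose restriction to each interval of the Markov partition is a
(positive) iterate of `f`. The iterate has to be defined on the interval, that is, the points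
`f^[i] x`, `i < m`, have to lie in the domain of `f`. -/
def IsRegularCantorSetFor (f : ℝ → ℝ) (K : Set ℝ) : Prop :=
  ∃ (r : ℕ) (a b : Fin r → ℝ) (ψ : ℝ → ℝ), IsRegularCantorSet K a b ψ ∧
    ∀ j, ∃ m : ℕ, 1 ≤ m ∧ ∀ x ∈ Icc (a j) (b j),
      (∀ i < m, f^[i] x ∈ puncturedInterval) ∧ ψ x = f^[m] x

/-! The Cantor sets come from full branches: disjoint intervals inside (1/8, 1/4), each mapped
diffeomorphically onto [1/8, 1/4] by an iterate of f. The points that never leave a finite family of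
such intervals form a regular Cantor set. By a Moran-type argument its dimension is at least s once
∑ κ_i ^ s ≥ 1, where κ_i is a lower Lipschitz constant of the i-th inverse branch
(`le_dimH_of_contractions`).

It remains to find, for each s < 1, enough branches. Remove a hole (-δ, δ) around the singularity.
The intervals p on which n iterates avoid the hole have length at most λ⁻ⁿ and distortion bounded
independently of n (`exists_inv_orbitWeight_le`). Since 1/f' has an integrable derivative, a
Lasota–Yorke inequality for the variation of 1/(fⁿ)' holds. It shows that the fraction η of length
lost per step can be made small with δ, and that at least half of the surviving length lies in
intervals whose n-th image is longer than some ℓ independent of n and δ (`exists_long_pieces`).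
Because λ² > 2, intervals grow under f until they cover [1/8, 1/4], so each long image contains an
interval sent onto [1/8, 1/4] with a uniform Lipschitz bound (`exists_uniform_reaches`). Hence p
contains a full branch with κ ≥ const · |p|, and ∑ |p|^s ≥ λ^(n(1-s)) ∑ |p| ≥ const · (λ^(1-s)
(1-η))ⁿ, which is unbounded in n when η is small (`exists_branches`).

For monotonicity, the branches for exponent s_k → 1 are taken in the k-th of a sequence of disjoint
windows, and the k-th Cantor set uses all windows up to the (k+1)-st. -/

/-! ### Lorenz maps on the open interval and their iterates. -/

/-- The interior of the domain of the one-dimensional Lorenz map. -/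
def puncturedInterior : Set ℝ := Ioo (-1 / 2 : ℝ) (1 / 2) \ {0}

/-- The properties of the one-dimensional Lorenz map, restricted to the interior of its domain,
on which the construction of Cantor sets depends. -/
structure IsLorenzMap (f : ℝ → ℝ) (lam B β : ℝ) : Prop where
  one_lt : 1 < lam
  two_lt_sq : 2 < lam ^ 2
  mapsTo : ∀ x ∈ puncturedInterior, f x ∈ Ioo (-1 / 2 : ℝ) (1 / 2)
  contDiffOn : ContDiffOn ℝ 2 f puncturedInterior
  le_deriv : ∀ x ∈ puncturedInterior, lam ≤ deriv f x
  tendsto_left : Tendsto f (𝓝[<] 0) (𝓝 (1 / 2))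
  tendsto_right : Tendsto f (𝓝[>] 0) (𝓝 (-1 / 2))
  pos_exponent : 0 < β
  exponent_lt_one : β < 1
  pos_bound : 0 < B
  abs_deriv_inv_le : ∀ x ∈ puncturedInterior,
    |deriv (fun y => (deriv f y)⁻¹) x| ≤ B * |x| ^ (-β)
  inv_deriv_small : ∀ τ > 0, ∃ δ > 0, ∀ x ∈ puncturedInterior, |x| ≤ δ → (deriv f x)⁻¹ ≤ τ
  deriv_bdd : ∀ δ > 0, ∃ M, ∀ x ∈ puncturedInterior, δ ≤ |x| → deriv f x ≤ M

/-- The set of points whose first `n` iterates lie in the interior of the domain. -/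
def orbitDomain (f : ℝ → ℝ) (n : ℕ) : Set ℝ := {x | ∀ i < n, f^[i] x ∈ puncturedInterior}

/-- The reciprocal of the derivative of the `n`-th iterate, as a product along the orbit. -/
noncomputable def orbitWeight (f : ℝ → ℝ) (n : ℕ) (x : ℝ) : ℝ :=
  ∏ i ∈ Finset.range n, (deriv f (f^[i] x))⁻¹

lemma isOpen_puncturedInterior : IsOpen puncturedInterior :=
  isOpen_Ioo.sdiff isClosed_singleton

lemma puncturedInterior_subset : puncturedInterior ⊆ puncturedInterval := by
  rintro x ⟨⟨h1, h2⟩, h3⟩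
  exact ⟨⟨h1.le, h2.le⟩, h3⟩

lemma mem_puncturedInterior_of_neg {x : ℝ} (h1 : -1 / 2 < x) (h2 : x < 0) :
    x ∈ puncturedInterior :=
  ⟨⟨h1, by linarith⟩, h2.ne⟩

lemma mem_puncturedInterior_of_pos {x : ℝ} (h1 : 0 < x) (h2 : x < 1 / 2) :
    x ∈ puncturedInterior :=
  ⟨⟨by linarith, h2⟩, h1.ne'⟩

lemma orbitDomain_zero (f : ℝ → ℝ) : orbitDomain f 0 = univ := by
  ext x; simp [orbitDomain]

lemma orbitDomain_succ (f : ℝ → ℝ) (n : ℕ) :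
    orbitDomain f (n + 1) = orbitDomain f n ∩ f^[n] ⁻¹' puncturedInterior := by
  ext x
  simp only [orbitDomain, mem_ofPred_eq, mem_inter_iff, mem_preimage]
  constructor
  · intro h
    exact ⟨fun i hi => h i (by omega), h n (by omega)⟩
  · rintro ⟨h1, h2⟩ i hi
    rcases Nat.lt_succ_iff_lt_or_eq.1 hi with h | rfl
    · exact h1 i h
    · exact h2

lemma orbitDomain_anti (f : ℝ → ℝ) {m n : ℕ} (h : m ≤ n) : orbitDomain f n ⊆ orbitDomain f m :=
  fun _ hx i hi => hx i (by omega)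

lemma orbitDomain_add {f : ℝ → ℝ} {n k : ℕ} {x : ℝ} (h1 : x ∈ orbitDomain f n)
    (h2 : f^[n] x ∈ orbitDomain f k) : x ∈ orbitDomain f (n + k) := by
  intro i hi
  rcases lt_or_ge i n with h | h
  · exact h1 i h
  · have := h2 (i - n) (by omega)
    rwa [← Function.iterate_add_apply, Nat.sub_add_cancel h] at this

lemma orbitWeight_succ (f : ℝ → ℝ) (n : ℕ) (x : ℝ) :
    orbitWeight f (n + 1) x = orbitWeight f n x * (deriv f (f^[n] x))⁻¹ :=
  Finset.prod_range_succ _ _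

namespace IsLorenzMap

variable {f : ℝ → ℝ} {lam B β : ℝ}

lemma deriv_pos (hf : IsLorenzMap f lam B β) {x : ℝ} (hx : x ∈ puncturedInterior) :
    0 < deriv f x := by
  have := hf.le_deriv x hx
  have := hf.one_lt
  linarith

lemma inv_deriv_le (hf : IsLorenzMap f lam B β) {x : ℝ} (hx : x ∈ puncturedInterior) :
    (deriv f x)⁻¹ ≤ lam⁻¹ := by
  have := hf.le_deriv x hx
  have := hf.one_lt
  gcongr

lemma hasDerivAt (hf : IsLorenzMap f lam B β) {x : ℝ} (hx : x ∈ puncturedInterior) :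
    HasDerivAt f (deriv f x) x :=
  ((hf.contDiffOn.contDiffAt (isOpen_puncturedInterior.mem_nhds hx)).differentiableAt
    (by norm_num)).hasDerivAt

lemma contDiffOn_inv_deriv (hf : IsLorenzMap f lam B β) :
    ContDiffOn ℝ 1 (fun y => (deriv f y)⁻¹) puncturedInterior := by
  apply ContDiffOn.inv
  · exact hf.contDiffOn.deriv_of_isOpen isOpen_puncturedInterior (by norm_num)
  · exact fun x hx => (hf.deriv_pos hx).ne'

lemma contDiffOn_iterate (hf : IsLorenzMap f lam B β) (n : ℕ) :
    IsOpen (orbitDomain f n) ∧ ContDiffOn ℝ 2 f^[n] (orbitDomain f n) := by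
  induction n with
  | zero =>
    rw [orbitDomain_zero]
    exact ⟨isOpen_univ, contDiffOn_id⟩
  | succ n ih =>
    rw [orbitDomain_succ]
    refine ⟨ih.2.continuousOn.isOpen_inter_preimage ih.1 isOpen_puncturedInterior, ?_⟩
    rw [Function.iterate_succ']
    exact hf.contDiffOn.comp (ih.2.mono inter_subset_left) (fun x hx => hx.2)

lemma isOpen_orbitDomain (hf : IsLorenzMap f lam B β) (n : ℕ) : IsOpen (orbitDomain f n) :=
  (hf.contDiffOn_iterate n).1

lemma continuousOn_iterate (hf : IsLorenzMap f lam B β) (n : ℕ) :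
    ContinuousOn f^[n] (orbitDomain f n) :=
  (hf.contDiffOn_iterate n).2.continuousOn

lemma orbitWeight_pos (hf : IsLorenzMap f lam B β) {n : ℕ} {x : ℝ} (hx : x ∈ orbitDomain f n) :
    0 < orbitWeight f n x :=
  Finset.prod_pos fun i hi => inv_pos.2 (hf.deriv_pos (hx i (Finset.mem_range.1 hi)))

lemma orbitWeight_le (hf : IsLorenzMap f lam B β) {n : ℕ} {x : ℝ} (hx : x ∈ orbitDomain f n) :
    orbitWeight f n x ≤ lam⁻¹ ^ n := by
  rw [orbitWeight, ← Finset.card_range n, ← Finset.prod_const, Finset.card_range]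
  refine Finset.prod_le_prod (fun i hi => ?_) (fun i hi => ?_)
  · exact (inv_pos.2 (hf.deriv_pos (hx i (Finset.mem_range.1 hi)))).le
  · exact hf.inv_deriv_le (hx i (Finset.mem_range.1 hi))

lemma hasDerivAt_iterate (hf : IsLorenzMap f lam B β) {n : ℕ} {x : ℝ} (hx : x ∈ orbitDomain f n) :
    HasDerivAt f^[n] (orbitWeight f n x)⁻¹ x := by
  induction n with
  | zero => simpa [orbitWeight] using hasDerivAt_id x
  | succ n ih =>
    rw [orbitDomain_succ] at hx
    have h := (hf.hasDerivAt hx.2).comp x (ih hx.1)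
    rw [Function.iterate_succ', orbitWeight_succ]
    rwa [mul_inv, inv_inv, mul_comm]

lemma contDiffOn_orbitWeight (hf : IsLorenzMap f lam B β) (n : ℕ) :
    ContDiffOn ℝ 1 (orbitWeight f n) (orbitDomain f n) := by
  have : orbitWeight f n = fun x => ∏ i ∈ Finset.range n, (deriv f (f^[i] x))⁻¹ := rfl
  rw [this]
  refine contDiffOn_prod fun i hi => ?_
  have hi' := Finset.mem_range.1 hi
  exact hf.contDiffOn_inv_deriv.comp
    (((hf.contDiffOn_iterate i).2.of_le (by norm_num)).mono (orbitDomain_anti f hi'.le))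
    (fun x hx => hx i hi')

lemma continuousOn_deriv_orbitWeight (hf : IsLorenzMap f lam B β) (n : ℕ) :
    ContinuousOn (deriv (orbitWeight f n)) (orbitDomain f n) :=
  (hf.contDiffOn_orbitWeight n).continuousOn_deriv_of_isOpen (hf.isOpen_orbitDomain n) (by norm_num)

lemma hasDerivAt_orbitWeight (hf : IsLorenzMap f lam B β) {n : ℕ} {x : ℝ}
    (hx : x ∈ orbitDomain f n) :
    HasDerivAt (orbitWeight f n) (deriv (orbitWeight f n) x) x :=
  (((hf.contDiffOn_orbitWeight n).contDiffAt
    ((hf.isOpen_orbitDomain n).mem_nhds hx)).differentiableAt (by norm_num)).hasDerivAt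

/-- Differentiating w_{n+1} = w_n · (1/f')∘fⁿ, the chain-rule factor (fⁿ)' cancels w_n exactly, so
the singular term enters with no growth factor. -/
lemma abs_deriv_orbitWeight_succ_le (hf : IsLorenzMap f lam B β) {n : ℕ} {x : ℝ}
    (hx : x ∈ orbitDomain f (n + 1)) :
    |deriv (orbitWeight f (n + 1)) x| ≤
      lam⁻¹ * |deriv (orbitWeight f n) x| + B * |f^[n] x| ^ (-β) := by
  rw [orbitDomain_succ] at hx
  obtain ⟨hx1, hx2 : f^[n] x ∈ puncturedInterior⟩ := hx
  have hg : HasDerivAt (fun y => (deriv f y)⁻¹) (deriv (fun y => (deriv f y)⁻¹) (f^[n] x))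
      (f^[n] x) :=
    ((hf.contDiffOn_inv_deriv.contDiffAt
      (isOpen_puncturedInterior.mem_nhds hx2)).differentiableAt (by norm_num)).hasDerivAt
  have h := (hf.hasDerivAt_orbitWeight hx1).mul (hg.comp x (hf.hasDerivAt_iterate hx1))
  have h' : HasDerivAt (orbitWeight f (n + 1)) _ x :=
    h.congr_of_eventuallyEq (Eventually.of_forall fun y => orbitWeight_succ f n y)
  rw [h'.deriv]
  have hw := hf.orbitWeight_pos hx1
  have e : orbitWeight f n x * (deriv (fun y => (deriv f y)⁻¹) (f^[n] x) * (orbitWeight f n x)⁻¹)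
      = deriv (fun y => (deriv f y)⁻¹) (f^[n] x) := by
    field_simp
  rw [e]
  refine (abs_add_le _ _).trans (add_le_add ?_ (hf.abs_deriv_inv_le _ hx2))
  rw [abs_mul, mul_comm]
  simp only [Function.comp]
  rw [abs_of_pos (inv_pos.2 (hf.deriv_pos hx2))]
  exact mul_le_mul_of_nonneg_right (hf.inv_deriv_le hx2) (abs_nonneg _)

/-- Mean value theorem for an iterate on an interval of its domain. -/
lemma exists_iterate_sub_eq (hf : IsLorenzMap f lam B β) {n : ℕ} {c d : ℝ} (hcd : c < d)
    (h : Icc c d ⊆ orbitDomain f n) :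
    ∃ ξ ∈ Ioo c d, f^[n] d - f^[n] c = (orbitWeight f n ξ)⁻¹ * (d - c) := by
  obtain ⟨ξ, hξ, h1⟩ := exists_hasDerivAt_eq_slope f^[n] (fun x => (orbitWeight f n x)⁻¹) hcd
    ((hf.continuousOn_iterate n).mono h)
    (fun x hx => hf.hasDerivAt_iterate (h (Ioo_subset_Icc_self hx)))
  refine ⟨ξ, hξ, ?_⟩
  rw [h1, div_mul_cancel₀ _ (sub_pos.2 hcd).ne']

lemma pow_mul_sub_le (hf : IsLorenzMap f lam B β) {n : ℕ} {c d : ℝ} (hcd : c ≤ d)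
    (h : Icc c d ⊆ orbitDomain f n) : lam ^ n * (d - c) ≤ f^[n] d - f^[n] c := by
  rcases hcd.eq_or_lt with rfl | hcd
  · simp
  obtain ⟨ξ, hξ, h1⟩ := hf.exists_iterate_sub_eq hcd h
  rw [h1]
  have h2 := hf.orbitWeight_le (h (Ioo_subset_Icc_self hξ))
  have h3 := hf.orbitWeight_pos (h (Ioo_subset_Icc_self hξ))
  have h4 : lam ^ n ≤ (orbitWeight f n ξ)⁻¹ := by
    rw [inv_pow] at h2
    exact (le_inv_comm₀ h3 (pow_pos (by linarith [hf.one_lt]) n)).1 h2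
  have : 0 ≤ d - c := by linarith
  gcongr

lemma sub_le_mul (hf : IsLorenzMap f lam B β) {n : ℕ} {c d m : ℝ} (hcd : c ≤ d)
    (h : Icc c d ⊆ orbitDomain f n) (hm : ∀ x ∈ Icc c d, orbitWeight f n x ≤ m) :
    d - c ≤ m * (f^[n] d - f^[n] c) := by
  rcases hcd.eq_or_lt with rfl | hcd
  · simp
  obtain ⟨ξ, hξ, h1⟩ := hf.exists_iterate_sub_eq hcd h
  have h3 := hf.orbitWeight_pos (h (Ioo_subset_Icc_self hξ))
  have h4 := hm ξ (Ioo_subset_Icc_self hξ)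
  have h5 : d - c = orbitWeight f n ξ * (f^[n] d - f^[n] c) := by
    rw [h1]; field_simp
  have h6 : 0 ≤ f^[n] d - f^[n] c := by
    rw [h1]
    have : 0 < d - c := by linarith
    positivity
  calc d - c = orbitWeight f n ξ * (f^[n] d - f^[n] c) := h5
    _ ≤ m * (f^[n] d - f^[n] c) := by gcongr

lemma strictMonoOn_iterate (hf : IsLorenzMap f lam B β) {n : ℕ} {c d : ℝ}
    (h : Icc c d ⊆ orbitDomain f n) : StrictMonoOn f^[n] (Icc c d) := by
  intro x hx y hy hxy
  have h1 := hf.pow_mul_sub_le hxy.le ((Icc_subset_Icc hx.1 hy.2).trans h)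
  have : 0 < lam ^ n * (y - x) :=
    mul_pos (pow_pos (by linarith [hf.one_lt]) n) (by linarith)
  linarith

lemma image_iterate_Icc (hf : IsLorenzMap f lam B β) {n : ℕ} {c d : ℝ} (hcd : c ≤ d)
    (h : Icc c d ⊆ orbitDomain f n) : f^[n] '' Icc c d = Icc (f^[n] c) (f^[n] d) := by
  apply Subset.antisymm
  · rintro _ ⟨x, hx, rfl⟩
    have hm := (hf.strictMonoOn_iterate h).monotoneOn
    exact ⟨hm (left_mem_Icc.2 hcd) hx hx.1, hm hx (right_mem_Icc.2 hcd) hx.2⟩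
  · exact intermediate_value_Icc hcd ((hf.continuousOn_iterate n).mono h)

lemma iterate_mem_Ioo (hf : IsLorenzMap f lam B β) {n : ℕ} {x : ℝ}
    (h0 : x ∈ Ioo (-1 / 2 : ℝ) (1 / 2)) (h : x ∈ orbitDomain f n) :
    f^[n] x ∈ Ioo (-1 / 2 : ℝ) (1 / 2) := by
  cases n with
  | zero => exact h0
  | succ n =>
    rw [Function.iterate_succ_apply']
    exact hf.mapsTo _ (h n (Nat.lt_succ_self n))

end IsLorenzMap

/-! ### Growth of intervals until they cover [1/8, 1/4]. -/

/-- The interval `[c, d]` contains an interval mapped by an iterate of `f` onto `[1/8, 1/4]`. -/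
def Reaches (f : ℝ → ℝ) (c d : ℝ) : Prop :=
  ∃ (c' d' : ℝ) (k : ℕ), c ≤ c' ∧ c' < d' ∧ d' ≤ d ∧ Icc c' d' ⊆ orbitDomain f k ∧
    f^[k] c' = 1 / 8 ∧ f^[k] d' = 1 / 4

lemma Reaches.mono {f : ℝ → ℝ} {c d c' d' : ℝ} (h : Reaches f c' d') (hc : c ≤ c') (hd : d' ≤ d) :
    Reaches f c d := by
  obtain ⟨x, y, k, h1, h2, h3, h4⟩ := h
  exact ⟨x, y, k, hc.trans h1, h2, h3.trans hd, h4⟩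

lemma reaches_of_le {f : ℝ → ℝ} {c d : ℝ} (hc : c ≤ 1 / 8) (hd : 1 / 4 ≤ d) : Reaches f c d :=
  ⟨1 / 8, 1 / 4, 0, hc, by norm_num, hd, by simp [orbitDomain_zero], rfl, rfl⟩

namespace IsLorenzMap

variable {f : ℝ → ℝ} {lam B β : ℝ}

lemma exists_pullback (hf : IsLorenzMap f lam B β) {n : ℕ} {c d c₁ d₁ : ℝ} (hcd : c ≤ d)
    (h : Icc c d ⊆ orbitDomain f n) (hc : f^[n] c ≤ c₁) (h₁ : c₁ < d₁) (hd : d₁ ≤ f^[n] d) :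
    ∃ c' d', c ≤ c' ∧ c' < d' ∧ d' ≤ d ∧ f^[n] c' = c₁ ∧ f^[n] d' = d₁ := by
  have hi := hf.image_iterate_Icc hcd h
  have hc₁ : c₁ ∈ f^[n] '' Icc c d := by rw [hi]; exact ⟨hc, h₁.le.trans hd⟩
  have hd₁ : d₁ ∈ f^[n] '' Icc c d := by rw [hi]; exact ⟨hc.trans h₁.le, hd⟩
  obtain ⟨c', hc', rfl⟩ := hc₁
  obtain ⟨d', hd', rfl⟩ := hd₁
  exact ⟨c', d', hc'.1, ((hf.strictMonoOn_iterate h).lt_iff_lt hc' hd').1 h₁, hd'.2, rfl, rfl⟩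

lemma subset_orbitDomain_add (hf : IsLorenzMap f lam B β) {n k : ℕ} {c d : ℝ} (hcd : c ≤ d)
    (h : Icc c d ⊆ orbitDomain f n) (h' : Icc (f^[n] c) (f^[n] d) ⊆ orbitDomain f k) :
    Icc c d ⊆ orbitDomain f (n + k) := by
  intro x hx
  refine orbitDomain_add (h hx) (h' ?_)
  rw [← hf.image_iterate_Icc hcd h]
  exact mem_image_of_mem _ hx

lemma reaches_of_iterate (hf : IsLorenzMap f lam B β) {n : ℕ} {c d : ℝ} (hcd : c ≤ d)
    (h : Icc c d ⊆ orbitDomain f n) (hr : Reaches f (f^[n] c) (f^[n] d)) : Reaches f c d := by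
  obtain ⟨x, y, k, h1, h2, h3, h4, h5, h6⟩ := hr
  obtain ⟨c', d', hc', hcd', hd', rfl, rfl⟩ := hf.exists_pullback hcd h h1 h2 h3
  refine ⟨c', d', n + k, hc', hcd', hd', ?_, ?_, ?_⟩
  · exact hf.subset_orbitDomain_add hcd'.le ((Icc_subset_Icc hc' hd').trans h) h4
  · rwa [add_comm, Function.iterate_add_apply]
  · rwa [add_comm, Function.iterate_add_apply]

lemma Icc_subset_orbitDomain_one {c d : ℝ} (h : Icc c d ⊆ puncturedInterior) :
    Icc c d ⊆ orbitDomain f 1 := by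
  intro x hx i hi
  obtain rfl : i = 0 := by omega
  exact h hx

lemma Icc_subset_of_neg {c d : ℝ} (hc : -1 / 2 < c) (hd : d < 0) : Icc c d ⊆ puncturedInterior :=
  fun _ hx => mem_puncturedInterior_of_neg (hc.trans_le hx.1) (hx.2.trans_lt hd)

lemma Icc_subset_of_pos {c d : ℝ} (hc : 0 < c) (hd : d < 1 / 2) : Icc c d ⊆ puncturedInterior :=
  fun _ hx => mem_puncturedInterior_of_pos (hc.trans_le hx.1) (hx.2.trans_lt hd)

lemma reaches_of_image (hf : IsLorenzMap f lam B β) {c d : ℝ} (hcd : c ≤ d)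
    (h : Icc c d ⊆ puncturedInterior) (hr : Reaches f (f c) (f d)) : Reaches f c d :=
  hf.reaches_of_iterate (n := 1) hcd (Icc_subset_orbitDomain_one h) hr

lemma mul_sub_le (hf : IsLorenzMap f lam B β) {c d : ℝ} (hcd : c ≤ d)
    (h : Icc c d ⊆ puncturedInterior) : lam * (d - c) ≤ f d - f c := by
  have := hf.pow_mul_sub_le (n := 1) hcd (Icc_subset_orbitDomain_one h)
  simpa using this

lemma exists_left_image_gt (hf : IsLorenzMap f lam B β) {y η : ℝ} (hy : y < 1 / 2) (hη : 0 < η) :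
    ∃ x, -η < x ∧ x < 0 ∧ y < f x := by
  have h1 := hf.tendsto_left.eventually (lt_mem_nhds hy)
  have h2 : ∀ᶠ x in 𝓝[<] (0 : ℝ), x ∈ Ioo (-η) 0 := Ioo_mem_nhdsLT (by linarith)
  obtain ⟨x, hx1, hx2⟩ := (h1.and h2).exists
  exact ⟨x, hx2.1, hx2.2, hx1⟩

lemma exists_right_image_lt (hf : IsLorenzMap f lam B β) {y η : ℝ} (hy : -1 / 2 < y)
    (hη : 0 < η) : ∃ x, 0 < x ∧ x < η ∧ f x < y := by
  have h1 := hf.tendsto_right.eventually (gt_mem_nhds hy)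
  have h2 : ∀ᶠ x in 𝓝[>] (0 : ℝ), x ∈ Ioo 0 η := Ioo_mem_nhdsGT hη
  obtain ⟨x, hx1, hx2⟩ := (h1.and h2).exists
  exact ⟨x, hx2.1, hx2.2, hx1⟩

lemma lam_gt (hf : IsLorenzMap f lam B β) : 7 / 5 < lam := by
  nlinarith [hf.two_lt_sq, hf.one_lt]

/-- Some compact interval inside `(-1/2, 0)` is such that every interval containing it reaches
`[1/8, 1/4]`. -/
lemma exists_reaches_neg (hf : IsLorenzMap f lam B β) :
    ∃ x y : ℝ, -1 / 2 < x ∧ x ≤ y ∧ y < 0 ∧ Reaches f x y := by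
  obtain ⟨y, hy1, hy2, hy3⟩ := hf.exists_left_image_gt (y := 1 / 4) (η := 1 / 100) (by norm_num)
    (by norm_num)
  have hs : Icc (-49 / 100) y ⊆ puncturedInterior := Icc_subset_of_neg (by norm_num) hy2
  have h1 := hf.mul_sub_le (by linarith) hs
  have h2 := (hf.mapsTo y (hs (right_mem_Icc.2 (by linarith)))).2
  refine ⟨-49 / 100, y, by norm_num, by linarith, hy2, hf.reaches_of_image (by linarith) hs ?_⟩
  -- The interval is longer than 48/100 and λ > 7/5, so its image is longer than 0.67; its top is
  -- below 1/2, hence its bottom is below 1/8.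
  refine reaches_of_le ?_ hy3.le
  nlinarith [hf.lam_gt]

/-- An interval either reaches `[1/8, 1/4]`, or this follows if a definitely longer one does. -/
lemma reaches_or_exists_longer (hf : IsLorenzMap f lam B β) {c d : ℝ} (hc : -1 / 2 < c)
    (hcd : c < d) (hd : d < 1 / 2) :
    Reaches f c d ∨ ∃ c' d', -1 / 2 < c' ∧ c' < d' ∧ d' < 1 / 2 ∧
      min lam ((lam ^ 2 / 2 + 1) / 2) * (d - c) ≤ d' - c' ∧ (Reaches f c' d' → Reaches f c d) := by
  have hl := hf.one_lt
  have hl2 := hf.two_lt_sq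
  -- An interval missing 0 grows by λ in one step. One containing 0 is cut there and its longer half
  -- followed for two steps, a gain of nearly λ²/2 > 1; the mean of λ²/2 and 1 leaves room for a
  -- small loss.
  have hmin1 := min_le_left lam ((lam ^ 2 / 2 + 1) / 2)
  have hmin2 := min_le_right lam ((lam ^ 2 / 2 + 1) / 2)
  have hpos : 0 < d - c := by linarith
  -- the image under one step of an interval of the domain
  have step1 : ∀ c₁ d₁, -1 / 2 < c₁ → c₁ < d₁ → d₁ < 1 / 2 → Icc c₁ d₁ ⊆ puncturedInterior →
      -1 / 2 < f c₁ ∧ f c₁ < f d₁ ∧ f d₁ < 1 / 2 ∧ lam * (d₁ - c₁) ≤ f d₁ - f c₁ := by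
    intro c₁ d₁ h1 h2 h3 h4
    have h5 := hf.mul_sub_le h2.le h4
    have h6 : 0 < lam * (d₁ - c₁) := mul_pos (by linarith) (by linarith)
    exact ⟨(hf.mapsTo c₁ (h4 (left_mem_Icc.2 h2.le))).1, by linarith,
      (hf.mapsTo d₁ (h4 (right_mem_Icc.2 h2.le))).2, h5⟩
  by_cases h0 : Icc c d ⊆ puncturedInterior
  · right
    obtain ⟨h1, h2, h3, h4⟩ := step1 c d hc hcd hd h0
    refine ⟨f c, f d, h1, h2, h3, ?_, hf.reaches_of_image hcd.le h0⟩
    exact (mul_le_mul_of_nonneg_right hmin1 hpos.le).trans h4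
  have h0' : c ≤ 0 ∧ 0 ≤ d := by
    constructor
    · by_contra! h
      exact h0 (Icc_subset_of_pos h hd)
    · by_contra! h
      exact h0 (Icc_subset_of_neg hc h)
  -- a loss that is small enough not to destroy the growth
  obtain ⟨η, hη, hη1, hη2⟩ : ∃ η > 0, lam ^ 2 * η ≤ (lam ^ 2 / 2 - 1) / 2 * (d - c) ∧
      η < (d - c) / 2 := by
    have hA : 0 < (lam ^ 2 / 2 - 1) / 2 * (d - c) := by
      apply mul_pos _ hpos; linarith
    have hl3 : 0 < lam ^ 2 := by positivity
    refine ⟨min ((lam ^ 2 / 2 - 1) / 2 * (d - c) / lam ^ 2) ((d - c) / 3), ?_, ?_, ?_⟩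
    · apply lt_min
      · positivity
      · linarith
    · calc lam ^ 2 * _ ≤ lam ^ 2 * ((lam ^ 2 / 2 - 1) / 2 * (d - c) / lam ^ 2) := by
            gcongr; exact min_le_left _ _
        _ = _ := by field_simp
    · exact (min_le_right _ _).trans_lt (by linarith)
  -- Two steps multiply (d - c)/2 - η by λ², and the choice of η leaves exactly the factor (λ²/2 +
  -- 1)/2. This needs the first image to avoid 0 as well.
  have key : ∀ c₁ d₁, c ≤ c₁ → c₁ < d₁ → d₁ ≤ d → (d - c) / 2 - η ≤ d₁ - c₁ →
      Icc c₁ d₁ ⊆ puncturedInterior → Icc (f c₁) (f d₁) ⊆ puncturedInterior →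
      ∃ c' d', -1 / 2 < c' ∧ c' < d' ∧ d' < 1 / 2 ∧
      min lam ((lam ^ 2 / 2 + 1) / 2) * (d - c) ≤ d' - c' ∧ (Reaches f c' d' → Reaches f c d) := by
    intro c₁ d₁ h1 h2 h3 h4 h5 h6
    obtain ⟨a1, a2, a3, a4⟩ := step1 c₁ d₁ (by linarith) h2 (by linarith) h5
    obtain ⟨b1, b2, b3, b4⟩ := step1 _ _ a1 a2 a3 h6
    refine ⟨_, _, b1, b2, b3, ?_, fun h => ?_⟩
    · have e1 : lam * (lam * (d₁ - c₁)) ≤ lam * (f d₁ - f c₁) := by gcongr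
      have e2 : lam ^ 2 * ((d - c) / 2 - η) ≤ lam ^ 2 * (d₁ - c₁) := by gcongr
      have e3 := mul_le_mul_of_nonneg_right hmin2 hpos.le
      nlinarith
    · exact (hf.reaches_of_image h2.le h5 (hf.reaches_of_image a2.le h6 h)).mono h1 h3
  by_cases hhalf : (d - c) / 2 ≤ -c
  -- Since f tends to 1/2 at 0⁻, an image starting at or below 0 already covers [1/8, 1/4];
  -- otherwise the image is in (0, 1/2) and avoids 0.
  · by_cases hfc : f c ≤ 0
    · left
      obtain ⟨x, hx1, hx2, hx3⟩ := hf.exists_left_image_gt (y := 1 / 4) (η := -c) (by norm_num)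
        (by linarith)
      refine (hf.reaches_of_image (by linarith) (Icc_subset_of_neg hc hx2)
        (reaches_of_le ?_ hx3.le) : Reaches f c x).mono le_rfl (by linarith)
      linarith
    · right
      push Not at hfc
      have hs : Icc c (-η) ⊆ puncturedInterior := Icc_subset_of_neg hc (by linarith)
      refine key c (-η) le_rfl (by linarith) (by linarith) (by linarith) hs
        (Icc_subset_of_pos hfc ?_)
      exact (hf.mapsTo _ (hs (right_mem_Icc.2 (by linarith)))).2
  · have hhalf' : (d - c) / 2 ≤ d := by linarith
    -- Since f tends to -1/2 at 0⁺, an image ending at or above 0 covers every compact subinterval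
    -- of (-1/2, 0), in particular the one of `exists_reaches_neg`.
    by_cases hfd : 0 ≤ f d
    · left
      obtain ⟨a, b, hab1, hab2, hab3, hab4⟩ := hf.exists_reaches_neg
      obtain ⟨x, hx1, hx2, hx3⟩ := hf.exists_right_image_lt hab1 (η := d) (by linarith)
      exact (hf.reaches_of_image (by linarith) (Icc_subset_of_pos hx1 hd)
        (hab4.mono hx3.le (by linarith)) : Reaches f x d).mono (by linarith) le_rfl
    · right
      push Not at hfd
      have hs : Icc η d ⊆ puncturedInterior := Icc_subset_of_pos hη hd
      refine key η d (by linarith) (by linarith) le_rfl (by linarith) hs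
        (Icc_subset_of_neg ?_ hfd)
      exact (hf.mapsTo _ (hs (left_mem_Icc.2 (by linarith)))).1

/-- Every nondegenerate interval contains an interval mapped onto `[1/8, 1/4]` by an iterate. -/
lemma reaches (hf : IsLorenzMap f lam B β) {c d : ℝ} (hc : -1 / 2 < c) (hcd : c < d)
    (hd : d < 1 / 2) : Reaches f c d := by
  set μ := min lam ((lam ^ 2 / 2 + 1) / 2) with hμ
  have hμ1 : 1 < μ := lt_min hf.one_lt (by linarith [hf.two_lt_sq])
  by_contra hcon
  -- A counterexample would produce counterexamples of geometrically growing length inside an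
  -- interval of length 1.
  have grow : ∀ n : ℕ, ∃ c' d', -1 / 2 < c' ∧ c' < d' ∧ d' < 1 / 2 ∧
      μ ^ n * (d - c) ≤ d' - c' ∧ ¬ Reaches f c' d' := by
    intro n
    induction n with
    | zero => exact ⟨c, d, hc, hcd, hd, by simp, hcon⟩
    | succ n ih =>
      obtain ⟨c₁, d₁, h1, h2, h3, h4, h5⟩ := ih
      rcases hf.reaches_or_exists_longer h1 h2 h3 with h | ⟨c₂, d₂, k1, k2, k3, k4, k5⟩
      · exact absurd h h5
      · refine ⟨c₂, d₂, k1, k2, k3, ?_, fun h => h5 (k5 h)⟩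
        calc μ ^ (n + 1) * (d - c) = μ * (μ ^ n * (d - c)) := by ring
          _ ≤ μ * (d₁ - c₁) := by gcongr
          _ ≤ _ := k4
  obtain ⟨n, hn⟩ := pow_unbounded_of_one_lt (1 / (d - c)) hμ1
  obtain ⟨c', d', h1, h2, h3, h4, h5⟩ := grow n
  rw [div_lt_iff₀ (by linarith)] at hn
  linarith

/-- A uniform version of `IsLorenzMap.reaches` for intervals of length at least `ℓ`. -/
lemma exists_uniform_reaches (hf : IsLorenzMap f lam B β) {ℓ : ℝ} (hℓ : 0 < ℓ) :
    ∃ M > 0, ∀ c d, -1 / 2 < c → d < 1 / 2 → ℓ ≤ d - c → ∃ (c' d' : ℝ) (k : ℕ),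
      c ≤ c' ∧ c' < d' ∧ d' ≤ d ∧ Icc c' d' ⊆ orbitDomain f k ∧
      f^[k] c' = 1 / 8 ∧ f^[k] d' = 1 / 4 ∧
      ∀ x ∈ Icc c' d', ∀ y ∈ Icc c' d', |f^[k] x - f^[k] y| ≤ M * |x - y| := by
  -- With mesh 1/N < ℓ/2 every interval of length ℓ contains a grid cell [i/N, (i+1)/N]. Only
  -- finitely many cells matter, so the Lipschitz constants have a common bound.
  obtain ⟨N, hN⟩ := exists_nat_gt (2 / ℓ)
  have hN0 : (0 : ℝ) < N := (by positivity : 0 < 2 / ℓ).trans hN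
  have hNℓ : 2 / N < ℓ := by rwa [div_lt_comm₀ hℓ hN0] at hN
  have single : ∀ i : ℤ, ∃ M : ℝ, -1 / 2 < (i / N : ℝ) → ((i + 1) / N : ℝ) < 1 / 2 →
      ∃ (c' d' : ℝ) (k : ℕ),
      i / N ≤ c' ∧ c' < d' ∧ d' ≤ (i + 1) / N ∧ Icc c' d' ⊆ orbitDomain f k ∧
      f^[k] c' = 1 / 8 ∧ f^[k] d' = 1 / 4 ∧
      ∀ x ∈ Icc c' d', ∀ y ∈ Icc c' d', |f^[k] x - f^[k] y| ≤ M * |x - y| := by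
    intro i
    by_cases h : -1 / 2 < (i / N : ℝ) ∧ ((i + 1) / N : ℝ) < 1 / 2
    · obtain ⟨c', d', k, h1, h2, h3, h4, h5, h6⟩ := hf.reaches h.1
        (by gcongr; linarith : (i / N : ℝ) < (i + 1) / N) h.2
      have hcont : ContinuousOn (fun x => (orbitWeight f k x)⁻¹) (Icc c' d') :=
        (((hf.contDiffOn_orbitWeight k).continuousOn.mono h4).inv₀
          fun x hx => (hf.orbitWeight_pos (h4 hx)).ne')
      obtain ⟨M, hM⟩ := isCompact_Icc.exists_bound_of_continuousOn hcont
      refine ⟨M, fun _ _ => ⟨c', d', k, h1, h2, h3, h4, h5, h6, fun x hx y hy => ?_⟩⟩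
      have := (convex_Icc c' d').norm_image_sub_le_of_norm_hasDerivWithin_le
        (fun z hz => (hf.hasDerivAt_iterate (h4 hz)).hasDerivWithinAt) hM hy hx
      simpa using this
    · exact ⟨0, fun h1 h2 => absurd ⟨h1, h2⟩ h⟩
  choose M hM using single
  obtain ⟨M₀, hM₀⟩ := ((Finset.Icc (-(N : ℤ)) N).image M).exists_le
  refine ⟨max M₀ 1, by positivity, fun c d hc hd hcd => ?_⟩
  set i : ℤ := ⌈c * N⌉ with hi
  have hi1 : c ≤ i / N := by
    rw [le_div_iff₀ hN0]; exact Int.le_ceil _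
  have hi2 : ((i + 1) / N : ℝ) ≤ d := by
    have : (i : ℝ) < c * N + 1 := Int.ceil_lt_add_one _
    rw [div_le_iff₀ hN0]
    rw [div_lt_iff₀ hN0] at hNℓ
    nlinarith
  have hmem : i ∈ Finset.Icc (-(N : ℤ)) N := by
    rw [Finset.mem_Icc]
    have e1 : (-(N : ℝ)) ≤ i := by
      have := (hc.trans_le hi1)
      rw [lt_div_iff₀ hN0] at this
      linarith
    have e2 : (i : ℝ) ≤ N := by
      have := (hi2.trans_lt hd)
      rw [div_lt_iff₀ hN0] at this
      linarith
    exact ⟨by exact_mod_cast e1, by exact_mod_cast e2⟩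
  obtain ⟨c', d', k, h1, h2, h3, h4, h5, h6, h7⟩ := hM i (hc.trans_le hi1) (hi2.trans_lt hd)
  refine ⟨c', d', k, hi1.trans h1, h2, h3.trans hi2, h4, h5, h6, fun x hx y hy => ?_⟩
  refine (h7 x hx y hy).trans ?_
  gcongr
  exact (hM₀ _ (Finset.mem_image_of_mem _ hmem)).trans (le_max_left _ _)

end IsLorenzMap

/-! ### Variation of 1/(fⁿ)' and escape through a small hole. -/

/-- `p` is an interval on which `n` iterates of `f` are defined and avoid the hole `(-δ, δ)`. -/
structure IsPiece (f : ℝ → ℝ) (δ : ℝ) (n : ℕ) (p : ℝ × ℝ) : Prop where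
  lt : p.1 < p.2
  left_gt : -1 / 2 < p.1
  right_lt : p.2 < 1 / 2
  le_abs : ∀ x ∈ Icc p.1 p.2, ∀ i < n, δ ≤ |f^[i] x|

/-- The total variation on the line of the weight `1 / (f^n)'`, extended by zero off the interval
`p`. -/
noncomputable def pieceVar (f : ℝ → ℝ) (n : ℕ) (p : ℝ × ℝ) : ℝ :=
  orbitWeight f n p.1 + orbitWeight f n p.2 + ∫ x in p.1..p.2, |deriv (orbitWeight f n) x|

/-- An integrable power singularity is bounded by a constant plus a derivative of a function with
small oscillation. -/
lemma exists_small_primitive {B β ε : ℝ} (hB : 0 < B) (hβ : 0 < β) (hβ1 : β < 1) (hε : 0 < ε) :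
    ∃ (N : ℝ) (R r : ℝ → ℝ), 0 ≤ N ∧ (∀ y ∈ puncturedInterior, HasDerivAt R (r y) y ∧ 0 ≤ r y ∧
      |R y| ≤ ε ∧ B * |y| ^ (-β) ≤ N + r y) := by
  -- Any exponent strictly between β and 1 would do: γ > β lets a small multiple of |y|^(-γ)
  -- dominate B|y|^(-β) near 0, and γ < 1 keeps its primitive bounded by ε.
  set γ := (1 + β) / 2 with hγ
  have hγ1 : γ < 1 := by rw [hγ]; linarith
  have hβγ : β < γ := by rw [hγ]; linarith
  set e := ε * (1 - γ) with he
  have he0 : 0 < e := mul_pos hε (by linarith)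
  -- The point where B t^(-β) = e t^(-γ); beyond it the constant B t₀^(-β) suffices.
  set t₀ := (e / B) ^ (1 / (γ - β)) with ht₀
  have ht₀0 : 0 < t₀ := by positivity
  refine ⟨B * t₀ ^ (-β), fun y => if 0 < y then ε * y ^ (1 - γ) else -(ε * (-y) ^ (1 - γ)),
    fun y => e * |y| ^ (-γ), by positivity, fun y hy => ⟨?_, by positivity, ?_, ?_⟩⟩
  · rcases lt_or_gt_of_ne (show y ≠ 0 from hy.2) with h | h
    · have h1 : HasDerivAt (fun y : ℝ => -(ε * (-y) ^ (1 - γ)))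
          (-(ε * (-1 * (1 - γ) * (-y) ^ (1 - γ - 1)))) y :=
        (((hasDerivAt_id y).neg.rpow_const (Or.inl (by simpa using h.ne))).const_mul ε).neg
      have h2 : e * |y| ^ (-γ) = -(ε * (-1 * (1 - γ) * (-y) ^ (1 - γ - 1))) := by
        rw [abs_of_neg h, he, show 1 - γ - 1 = -γ by ring]; ring
      beta_reduce
      rw [h2]
      refine h1.congr_of_eventuallyEq ?_
      filter_upwards [Iio_mem_nhds h] with z hz
      rw [if_neg (not_lt.2 (le_of_lt hz))]
    · have h1 : HasDerivAt (fun y : ℝ => ε * y ^ (1 - γ))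
          (ε * (1 * (1 - γ) * y ^ (1 - γ - 1))) y :=
        (((hasDerivAt_id y).rpow_const (Or.inl (by simpa using h.ne'))).const_mul ε)
      have h2 : e * |y| ^ (-γ) = ε * (1 * (1 - γ) * y ^ (1 - γ - 1)) := by
        rw [abs_of_pos h, he, show 1 - γ - 1 = -γ by ring]; ring
      beta_reduce
      rw [h2]
      refine h1.congr_of_eventuallyEq ?_
      filter_upwards [Ioi_mem_nhds h] with z hz
      rw [if_pos (mem_Ioi.1 hz)]
  · have key : ∀ z : ℝ, 0 ≤ z → z ≤ 1 → |ε * z ^ (1 - γ)| ≤ ε := by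
      intro z h0 h1
      rw [abs_of_nonneg (by positivity)]
      have := Real.rpow_le_one h0 h1 (by linarith : 0 ≤ 1 - γ)
      nlinarith
    have h1 := hy.1.1
    have h2 := hy.1.2
    beta_reduce
    split_ifs with h
    · exact key y h.le (by linarith)
    · rw [abs_neg]
      exact key (-y) (by linarith) (by linarith)
  · have hy0 : 0 < |y| := abs_pos.2 hy.2
    by_cases h : |y| ≤ t₀
    · have h1 : |y| ^ (γ - β) ≤ e / B := by
        calc |y| ^ (γ - β) ≤ t₀ ^ (γ - β) :=
              Real.rpow_le_rpow hy0.le h (by linarith)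
          _ = e / B := by
            rw [ht₀, ← Real.rpow_mul (by positivity), one_div, inv_mul_cancel₀ (by linarith),
              Real.rpow_one]
      have h2 : |y| ^ (-β) = |y| ^ (γ - β) * |y| ^ (-γ) := by
        rw [← Real.rpow_add hy0]; congr 1; ring
      have h3 : B * |y| ^ (-β) ≤ e * |y| ^ (-γ) := by
        rw [h2, ← mul_assoc]
        have : B * |y| ^ (γ - β) ≤ e := by
          rw [le_div_iff₀ hB] at h1; linarith
        gcongr
      have : 0 ≤ B * t₀ ^ (-β) := by positivity
      linarith
    · push Not at h
      have h1 : |y| ^ (-β) ≤ t₀ ^ (-β) :=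
        Real.rpow_le_rpow_of_nonpos ht₀0 h.le (by linarith)
      have : B * |y| ^ (-β) ≤ B * t₀ ^ (-β) := by gcongr
      have : 0 ≤ e * |y| ^ (-γ) := by positivity
      linarith

namespace IsLorenzMap

variable {f : ℝ → ℝ} {lam B β : ℝ}

lemma subset_orbitDomain (hf : IsLorenzMap f lam B β) {δ : ℝ} (hδ : 0 < δ) {n : ℕ} {p : ℝ × ℝ}
    (hp : IsPiece f δ n p) : Icc p.1 p.2 ⊆ orbitDomain f n := by
  intro x hx
  have h0 : x ∈ Ioo (-1 / 2 : ℝ) (1 / 2) :=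
    ⟨hp.left_gt.trans_le hx.1, hx.2.trans_lt hp.right_lt⟩
  have : ∀ k ≤ n, x ∈ orbitDomain f k := by
    intro k
    induction k with
    | zero => simp [orbitDomain_zero]
    | succ k ih =>
      intro hk
      have h1 := ih (by omega)
      rw [orbitDomain_succ]
      refine ⟨h1, hf.iterate_mem_Ioo h0 h1, ?_⟩
      have := hp.le_abs x hx k (by omega)
      intro h2
      rw [mem_singleton_iff] at h2
      rw [h2, abs_zero] at this
      linarith
  exact this n le_rfl

lemma intervalIntegrable_abs_deriv (hf : IsLorenzMap f lam B β) {n : ℕ} {c d : ℝ} (hcd : c ≤ d)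
    (h : Icc c d ⊆ orbitDomain f n) :
    IntervalIntegrable (fun x => |deriv (orbitWeight f n) x|) MeasureTheory.volume c d := by
  apply ContinuousOn.intervalIntegrable
  rw [uIcc_of_le hcd]
  exact ((hf.continuousOn_deriv_orbitWeight n).mono h).abs

lemma abs_orbitWeight_sub_le (hf : IsLorenzMap f lam B β) {n : ℕ} {c d : ℝ} (hcd : c ≤ d)
    (h : Icc c d ⊆ orbitDomain f n) :
    |orbitWeight f n d - orbitWeight f n c| ≤ ∫ x in c..d, |deriv (orbitWeight f n) x| := by
  rw [← intervalIntegral.integral_eq_sub_of_hasDerivAt (f := orbitWeight f n)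
    (f' := deriv (orbitWeight f n))]
  · exact intervalIntegral.abs_integral_le_integral_abs hcd
  · rw [uIcc_of_le hcd]
    exact fun x hx => hf.hasDerivAt_orbitWeight (h hx)
  · apply ContinuousOn.intervalIntegrable
    rw [uIcc_of_le hcd]
    exact (hf.continuousOn_deriv_orbitWeight n).mono h

/-- Extended by zero, the weight must rise from 0 to its value at x and fall back to 0, so its
variation is at least twice that value. -/
lemma two_mul_orbitWeight_le (hf : IsLorenzMap f lam B β) {n : ℕ} {p : ℝ × ℝ}
    (h : Icc p.1 p.2 ⊆ orbitDomain f n) {x : ℝ} (hx : x ∈ Icc p.1 p.2) :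
    2 * orbitWeight f n x ≤ pieceVar f n p := by
  have s1 := (Icc_subset_Icc_right hx.2).trans h
  have s2 := (Icc_subset_Icc_left hx.1).trans h
  have h1 := (le_abs_self _).trans (hf.abs_orbitWeight_sub_le hx.1 s1)
  have h2 := (neg_abs_le _).trans' (neg_le_neg (hf.abs_orbitWeight_sub_le hx.2 s2))
  have h3 := intervalIntegral.integral_add_adjacent_intervals
    (hf.intervalIntegrable_abs_deriv hx.1 s1) (hf.intervalIntegrable_abs_deriv hx.2 s2)
  rw [pieceVar]
  linarith

lemma pieceVar_nonneg (hf : IsLorenzMap f lam B β) {n : ℕ} {p : ℝ × ℝ} (hp : p.1 ≤ p.2)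
    (h : Icc p.1 p.2 ⊆ orbitDomain f n) : 0 ≤ pieceVar f n p := by
  have := hf.two_mul_orbitWeight_le h (left_mem_Icc.2 hp)
  have := hf.orbitWeight_pos (h (left_mem_Icc.2 hp))
  linarith

/-- The Lasota–Yorke inequality for the variation in the interior of an interval. -/
lemma integral_deriv_orbitWeight_succ_le (hf : IsLorenzMap f lam B β) {N ε m : ℝ} {R r : ℝ → ℝ}
    (hR : ∀ y ∈ puncturedInterior, HasDerivAt R (r y) y ∧ 0 ≤ r y ∧
      |R y| ≤ ε ∧ B * |y| ^ (-β) ≤ N + r y) {n : ℕ} {c d : ℝ} (hcd : c ≤ d)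
    (h : Icc c d ⊆ orbitDomain f (n + 1)) (hm : ∀ x ∈ Icc c d, orbitWeight f n x ≤ m) :
    ∫ x in c..d, |deriv (orbitWeight f (n + 1)) x| ≤
      lam⁻¹ * (∫ x in c..d, |deriv (orbitWeight f n) x|) + N * (d - c) + 2 * m * ε := by
  have hn : Icc c d ⊆ orbitDomain f n := h.trans (orbitDomain_anti f (Nat.le_succ n))
  have hF : ∀ x ∈ Icc c d, f^[n] x ∈ puncturedInterior := fun x hx => h hx n (Nat.lt_succ_self n)
  have i1 := hf.intervalIntegrable_abs_deriv hcd h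
  have i2 := (hf.intervalIntegrable_abs_deriv hcd hn).const_mul lam⁻¹
  -- Since m bounds w_n = 1/(fⁿ)', the derivative of N x + m R(fⁿ x) is at least N + r(fⁿ x), which
  -- dominates the singular term. The increment of m R(fⁿ x) is at most 2mε, however large its
  -- derivative is.
  have hd : ∀ x ∈ Icc c d, HasDerivAt (fun x => N * x + m * R (f^[n] x))
      (N * 1 + m * (r (f^[n] x) * (orbitWeight f n x)⁻¹)) x := by
    intro x hx
    exact ((hasDerivAt_id x).const_mul N).add
      (((hR _ (hF x hx)).1.comp x (hf.hasDerivAt_iterate (hn hx))).const_mul m)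
  have key := intervalIntegral.integral_le_sub_of_hasDeriv_right_of_le hcd
    (g := fun x => N * x + m * R (f^[n] x))
    (g' := fun x => N * 1 + m * (r (f^[n] x) * (orbitWeight f n x)⁻¹))
    (φ := fun x => |deriv (orbitWeight f (n + 1)) x| - lam⁻¹ * |deriv (orbitWeight f n) x|)
    (fun x hx => (hd x hx).continuousAt.continuousWithinAt)
    (fun x hx => (hd x (Ioo_subset_Icc_self hx)).hasDerivWithinAt) ?_ ?_
  · rw [intervalIntegral.integral_sub i1 i2, intervalIntegral.integral_const_mul] at key
    have hm0 : 0 ≤ m := (hf.orbitWeight_pos (hn (left_mem_Icc.2 hcd))).le.trans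
      (hm c (left_mem_Icc.2 hcd))
    have r1 := (le_abs_self _).trans (hR _ (hF d (right_mem_Icc.2 hcd))).2.2.1
    have r2 := (neg_abs_le _).trans' (neg_le_neg (hR _ (hF c (left_mem_Icc.2 hcd))).2.2.1)
    have : m * (R (f^[n] d) - R (f^[n] c)) ≤ m * (2 * ε) := by
      gcongr; linarith
    linarith
  · exact (intervalIntegrable_iff_integrableOn_Icc_of_le hcd).1 (i1.sub i2)
  · intro x hx
    have hx' := Ioo_subset_Icc_self hx
    have h1 := hf.abs_deriv_orbitWeight_succ_le (h hx')
    obtain ⟨-, h2, -, h3⟩ := hR _ (hF x hx')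
    have h4 := hf.orbitWeight_pos (hn hx')
    have h5 : r (f^[n] x) ≤ m * (r (f^[n] x) * (orbitWeight f n x)⁻¹) := by
      calc r (f^[n] x) = orbitWeight f n x * (r (f^[n] x) * (orbitWeight f n x)⁻¹) := by
            field_simp
        _ ≤ _ := by
          have := hm x hx'
          gcongr
    linarith

/-- The endpoints of the two parts of an interval that are left when a hole in its image is
removed. -/
lemma exists_cut (hf : IsLorenzMap f lam B β) {δ : ℝ} (hδ : 0 < δ) {n : ℕ} {c d : ℝ} (hcd : c < d)
    (h : Icc c d ⊆ orbitDomain f n) :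
    ∃ x₁ x₂, c ≤ x₁ ∧ x₁ ≤ x₂ ∧ x₂ ≤ d ∧
      (c < x₁ → f^[n] x₁ ≤ -δ ∧ (x₁ = d ∨ f^[n] x₁ = -δ)) ∧
      (x₂ < d → δ ≤ f^[n] x₂ ∧ (x₂ = c ∨ f^[n] x₂ = δ)) ∧
      f^[n] x₂ - f^[n] x₁ ≤ 2 * δ := by
  by_cases h1 : f^[n] d ≤ -δ
  · refine ⟨d, d, hcd.le, le_rfl, le_rfl, fun _ => ⟨h1, Or.inl rfl⟩, fun h => absurd h (lt_irrefl _),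
      by linarith⟩
  by_cases h2 : δ ≤ f^[n] c
  · refine ⟨c, c, le_rfl, le_rfl, hcd.le, fun h => absurd h (lt_irrefl _), fun _ => ⟨h2, Or.inl rfl⟩,
      by linarith⟩
  push Not at h1 h2
  have hmono := hf.strictMonoOn_iterate h
  have hcont := (hf.continuousOn_iterate n).mono h
  have hlr : f^[n] c < f^[n] d := hmono (left_mem_Icc.2 hcd.le) (right_mem_Icc.2 hcd.le) hcd
  obtain ⟨x₁, hx₁, e1, e2, e3⟩ : ∃ x₁ ∈ Icc c d, (c < x₁ → f^[n] x₁ = -δ) ∧ -δ ≤ f^[n] x₁ ∧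
      (x₁ = c ∨ f^[n] x₁ = -δ) := by
    by_cases h3 : f^[n] c ≤ -δ
    · obtain ⟨x, hx, hx'⟩ := intermediate_value_Icc hcd.le hcont ⟨h3, h1.le⟩
      exact ⟨x, hx, fun _ => hx', hx'.ge, Or.inr hx'⟩
    · exact ⟨c, left_mem_Icc.2 hcd.le, fun h => absurd h (lt_irrefl _), by linarith, Or.inl rfl⟩
  obtain ⟨x₂, hx₂, k1, k2, k3⟩ : ∃ x₂ ∈ Icc c d, (x₂ < d → f^[n] x₂ = δ) ∧ f^[n] x₂ ≤ δ ∧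
      (x₂ = d ∨ f^[n] x₂ = δ) := by
    by_cases h3 : δ ≤ f^[n] d
    · obtain ⟨x, hx, hx'⟩ := intermediate_value_Icc hcd.le hcont ⟨h2.le, h3⟩
      exact ⟨x, hx, fun _ => hx', hx'.le, Or.inr hx'⟩
    · exact ⟨d, right_mem_Icc.2 hcd.le, fun h => absurd h (lt_irrefl _), by linarith, Or.inl rfl⟩
  refine ⟨x₁, x₂, hx₁.1, ?_, hx₂.2, fun h => ⟨(e1 h).le, Or.inr (e1 h)⟩,
    fun h => ⟨(k1 h).ge, Or.inr (k1 h)⟩, by linarith⟩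
  rcases e3 with rfl | e3
  · exact hx₂.1
  rcases k3 with rfl | k3
  · exact hx₁.2
  refine ((hmono.lt_iff_lt hx₁ hx₂).1 ?_).le
  linarith

lemma isPiece_succ (hf : IsLorenzMap f lam B β) {δ : ℝ} (hδ : 0 < δ) {n : ℕ} {p : ℝ × ℝ}
    (hp : IsPiece f δ n p) {c d : ℝ} (hc : p.1 ≤ c) (hcd : c < d) (hd : d ≤ p.2)
    (h : f^[n] d ≤ -δ ∨ δ ≤ f^[n] c) : IsPiece f δ (n + 1) (c, d) := by
  have hs : Icc c d ⊆ Icc p.1 p.2 := Icc_subset_Icc hc hd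
  refine ⟨hcd, hp.left_gt.trans_le hc, hd.trans_lt hp.right_lt, fun x hx i hi => ?_⟩
  rcases Nat.lt_succ_iff_lt_or_eq.1 hi with h1 | rfl
  · exact hp.le_abs x (hs hx) i h1
  · have hmono := (hf.strictMonoOn_iterate (hs.trans (hf.subset_orbitDomain hδ hp))).monotoneOn
    rcases h with h | h
    · have := hmono hx (right_mem_Icc.2 hcd.le) hx.2
      exact le_abs.2 (Or.inr (by linarith))
    · have := hmono (left_mem_Icc.2 hcd.le) hx hx.1
      exact le_abs.2 (Or.inl (by linarith))

/-- Removing the hole from the image of an interval leaves at most two intervals. Their total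
variation satisfies a Lasota–Yorke inequality and little length is lost. -/
lemma exists_children (hf : IsLorenzMap f lam B β) {N ε τ δ : ℝ} {R r : ℝ → ℝ}
    (hN : 0 ≤ N) (hε : 0 ≤ ε)
    (hR : ∀ y ∈ puncturedInterior, HasDerivAt R (r y) y ∧ 0 ≤ r y ∧
      |R y| ≤ ε ∧ B * |y| ^ (-β) ≤ N + r y) (hδ : 0 < δ) (hτ : 0 ≤ τ)
    (hδτ : ∀ y ∈ puncturedInterior, |y| ≤ δ → (deriv f y)⁻¹ ≤ τ) {n : ℕ} {p : ℝ × ℝ}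
    (hp : IsPiece f δ n p) :
    ∃ S : Finset (ℝ × ℝ), (∀ q ∈ S, IsPiece f δ (n + 1) q ∧ p.1 ≤ q.1 ∧ q.2 ≤ p.2) ∧
      (S : Set (ℝ × ℝ)).PairwiseDisjoint (fun q => Icc q.1 q.2) ∧
      ∑ q ∈ S, pieceVar f (n + 1) q ≤
        (lam⁻¹ + τ + 2 * ε) * pieceVar f n p + N * (p.2 - p.1) ∧
      (p.2 - p.1) - δ * pieceVar f n p ≤ ∑ q ∈ S, (q.2 - q.1) := by
  obtain ⟨c, d⟩ := p
  have hcd : c < d := hp.lt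
  have hs : Icc c d ⊆ orbitDomain f n := hf.subset_orbitDomain hδ hp
  obtain ⟨x₁, x₂, h1, h2, h3, hL, hRt, hgap⟩ := hf.exists_cut hδ hcd hs
  simp only
  set V := pieceVar f n (c, d) with hV
  have hV0 : 0 ≤ V := hf.pieceVar_nonneg hcd.le hs
  have hm : ∀ x ∈ Icc c d, orbitWeight f n x ≤ V / 2 := fun x hx => by
    have := hf.two_mul_orbitWeight_le (p := (c, d)) hs hx
    linarith
  have s1 : Icc c x₁ ⊆ Icc c d := Icc_subset_Icc le_rfl (h2.trans h3)
  have s2 : Icc x₁ x₂ ⊆ Icc c d := Icc_subset_Icc h1 h3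
  have s3 : Icc x₂ d ⊆ Icc c d := Icc_subset_Icc (h1.trans h2) le_rfl
  set I₁ := ∫ x in c..x₁, |deriv (orbitWeight f n) x| with hI₁
  set I₂ := ∫ x in x₁..x₂, |deriv (orbitWeight f n) x| with hI₂
  set I₃ := ∫ x in x₂..d, |deriv (orbitWeight f n) x| with hI₃
  have pI₁ : 0 ≤ I₁ := intervalIntegral.integral_nonneg h1 fun _ _ => abs_nonneg _
  have pI₂ : 0 ≤ I₂ := intervalIntegral.integral_nonneg h2 fun _ _ => abs_nonneg _
  have pI₃ : 0 ≤ I₃ := intervalIntegral.integral_nonneg h3 fun _ _ => abs_nonneg _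
  have hI : V = orbitWeight f n c + orbitWeight f n d + (I₁ + I₂ + I₃) := by
    have i1 := hf.intervalIntegrable_abs_deriv h1 (s1.trans hs)
    have i2 := hf.intervalIntegrable_abs_deriv h2 (s2.trans hs)
    have i3 := hf.intervalIntegrable_abs_deriv h3 (s3.trans hs)
    rw [hI₁, hI₂, hI₃, intervalIntegral.integral_add_adjacent_intervals i1 i2,
      intervalIntegral.integral_add_adjacent_intervals (i1.trans i2) i3]
    rfl
  -- The removed part has image of length at most 2δ and weight at most V/2.
  have hlen : x₂ - x₁ ≤ δ * V := by
    have := hf.sub_le_mul h2 (s2.trans hs) (fun x hx => hm x (s2 hx))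
    have : V / 2 * (f^[n] x₂ - f^[n] x₁) ≤ V / 2 * (2 * δ) := by gcongr
    linarith
  have pc : 0 < orbitWeight f n c := hf.orbitWeight_pos (hs (left_mem_Icc.2 hcd.le))
  have pd : 0 < orbitWeight f n d := hf.orbitWeight_pos (hs (right_mem_Icc.2 hcd.le))
  have hl0 : 0 < lam⁻¹ := inv_pos.2 (by linarith [hf.one_lt])
  have wt : ∀ x ∈ Icc c d, f^[n] x ∈ puncturedInterior →
      orbitWeight f (n + 1) x ≤ lam⁻¹ * orbitWeight f n x := by
    intro x hx hx'
    rw [orbitWeight_succ, mul_comm]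
    exact mul_le_mul_of_nonneg_right (hf.inv_deriv_le hx') (hf.orbitWeight_pos (hs hx)).le
  -- An endpoint created by the cut lies over ±δ, where 1/f' ≤ τ. This is why new endpoints do not
  -- spoil the contraction.
  have wt' : ∀ x ∈ Icc c d, f^[n] x ∈ puncturedInterior → |f^[n] x| ≤ δ →
      orbitWeight f (n + 1) x ≤ τ * (V / 2) := by
    intro x hx hx' hx''
    rw [orbitWeight_succ, mul_comm]
    exact mul_le_mul (hδτ _ hx' hx'') (hm x hx) (hf.orbitWeight_pos (hs hx)).le hτ
  have left : c < x₁ → IsPiece f δ (n + 1) (c, x₁) ∧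
      pieceVar f (n + 1) (c, x₁) ≤ lam⁻¹ * orbitWeight f n c + orbitWeight f (n + 1) x₁ +
        (lam⁻¹ * I₁ + N * (x₁ - c) + V * ε) ∧ f^[n] x₁ ∈ puncturedInterior := by
    intro h
    have hq := hf.isPiece_succ hδ hp (c := c) (d := x₁) le_rfl h (h2.trans h3) (Or.inl (hL h).1)
    have hq' := hf.subset_orbitDomain hδ hq
    have key := hf.integral_deriv_orbitWeight_succ_le hR h.le hq' (fun x hx => hm x (s1 hx))
    have := wt c (left_mem_Icc.2 hcd.le) (hq' (left_mem_Icc.2 h.le) n (Nat.lt_succ_self n))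
    refine ⟨hq, ?_, hq' (right_mem_Icc.2 h.le) n (Nat.lt_succ_self n)⟩
    rw [pieceVar]
    simp only
    linarith
  have right : x₂ < d → IsPiece f δ (n + 1) (x₂, d) ∧
      pieceVar f (n + 1) (x₂, d) ≤ orbitWeight f (n + 1) x₂ + lam⁻¹ * orbitWeight f n d +
        (lam⁻¹ * I₃ + N * (d - x₂) + V * ε) ∧ f^[n] x₂ ∈ puncturedInterior := by
    intro h
    have hq := hf.isPiece_succ hδ hp (c := x₂) (d := d) (h1.trans h2) h le_rfl (Or.inr (hRt h).1)
    have hq' := hf.subset_orbitDomain hδ hq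
    have key := hf.integral_deriv_orbitWeight_succ_le hR h.le hq' (fun x hx => hm x (s3 hx))
    have := wt d (right_mem_Icc.2 hcd.le) (hq' (right_mem_Icc.2 h.le) n (Nat.lt_succ_self n))
    refine ⟨hq, ?_, hq' (left_mem_Icc.2 h.le) n (Nat.lt_succ_self n)⟩
    rw [pieceVar]
    simp only
    linarith
  -- The inner end of a part is either a new cut, costing τV/2, or the old opposite endpoint when
  -- nothing remains on the other side. If both parts survive, both inner ends are cuts.
  have leftEnd : c < x₁ → orbitWeight f (n + 1) x₁ ≤ lam⁻¹ * orbitWeight f n d + τ * (V / 2) ∧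
      (x₁ < d → orbitWeight f (n + 1) x₁ ≤ τ * (V / 2)) := by
    intro h
    have hU := (left h).2.2
    have hx : x₁ ∈ Icc c d := ⟨h1, h2.trans h3⟩
    have e1 : 0 ≤ τ * (V / 2) := by positivity
    have e2 : 0 < lam⁻¹ * orbitWeight f n d := by positivity
    rcases (hL h).2 with h4 | h4
    · subst h4
      exact ⟨by linarith [wt x₁ hx hU], fun h => absurd h (lt_irrefl _)⟩
    · have := wt' x₁ hx hU (by rw [h4, abs_neg, abs_of_pos hδ])
      exact ⟨by linarith, fun _ => this⟩
  have rightEnd : x₂ < d → orbitWeight f (n + 1) x₂ ≤ lam⁻¹ * orbitWeight f n c + τ * (V / 2) ∧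
      (c < x₂ → orbitWeight f (n + 1) x₂ ≤ τ * (V / 2)) := by
    intro h
    have hU := (right h).2.2
    have hx : x₂ ∈ Icc c d := ⟨h1.trans h2, h3⟩
    have e1 : 0 ≤ τ * (V / 2) := by positivity
    have e2 : 0 < lam⁻¹ * orbitWeight f n c := by positivity
    rcases (hRt h).2 with h4 | h4
    · subst h4
      exact ⟨by linarith [wt x₂ hx hU], fun h => absurd h (lt_irrefl _)⟩
    · have := wt' x₂ hx hU (by rw [h4, abs_of_pos hδ])
      exact ⟨by linarith, fun _ => this⟩
  have hVε : 0 ≤ V * ε := by positivity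
  have hVτ : 0 ≤ V * τ := by positivity
  have a1 : 0 ≤ lam⁻¹ * I₁ := by positivity
  have a2 : 0 ≤ lam⁻¹ * I₂ := by positivity
  have a3 : 0 ≤ lam⁻¹ * I₃ := by positivity
  have ac : 0 ≤ lam⁻¹ * orbitWeight f n c := by positivity
  have ad : 0 ≤ lam⁻¹ * orbitWeight f n d := by positivity
  have n1 : 0 ≤ N * (x₁ - c) := mul_nonneg hN (by linarith)
  have n2 : 0 ≤ N * (x₂ - x₁) := mul_nonneg hN (by linarith)
  have n3 : 0 ≤ N * (d - x₂) := mul_nonneg hN (by linarith)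
  -- The factor λ⁻¹ accounts for the old endpoints and the old integral, τ for two new endpoints at
  -- τV/2 each, and 2ε for the boundary terms Vε of two parts.
  have hexp : (lam⁻¹ + τ + 2 * ε) * V = lam⁻¹ * orbitWeight f n c + lam⁻¹ * orbitWeight f n d +
      (lam⁻¹ * I₁ + lam⁻¹ * I₂ + lam⁻¹ * I₃) + V * τ + 2 * (V * ε) := by
    have : lam⁻¹ * V = lam⁻¹ * (orbitWeight f n c + orbitWeight f n d + (I₁ + I₂ + I₃)) := by
      rw [← hI]
    linarith
  have hNexp : N * (d - c) = N * (x₁ - c) + N * (x₂ - x₁) + N * (d - x₂) := by ring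
  by_cases hl : c < x₁ <;> by_cases hr : x₂ < d
  · obtain ⟨l1, l2, -⟩ := left hl
    obtain ⟨r1, r2, -⟩ := right hr
    have l3 := (leftEnd hl).2 (h2.trans_lt hr)
    have r3 := (rightEnd hr).2 (hl.trans_le h2)
    have hx12 : x₁ < x₂ := by
      refine lt_of_le_of_ne h2 fun h => ?_
      have e1 := (hL hl).1
      have e2 := (hRt hr).1
      rw [h] at e1
      linarith
    have hne : ((c, x₁) : ℝ × ℝ) ≠ (x₂, d) := fun h => by
      have := (Prod.mk.inj h).1
      linarith
    have hdisj : Disjoint (Icc c x₁) (Icc x₂ d) :=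
      Set.disjoint_left.2 fun x hx hx' => by linarith [hx.2, hx'.1]
    refine ⟨{(c, x₁), (x₂, d)}, ?_, ?_, ?_, ?_⟩
    · intro q hq
      rcases Finset.mem_insert.1 hq with rfl | hq
      · exact ⟨l1, le_rfl, h2.trans h3⟩
      · rw [Finset.mem_singleton.1 hq]
        exact ⟨r1, h1.trans h2, le_rfl⟩
    · intro q hq q' hq' hqq
      simp only [Finset.coe_insert, Finset.coe_singleton, mem_insert_iff, mem_singleton_iff]
        at hq hq'
      rcases hq with rfl | rfl <;> rcases hq' with rfl | rfl
      · exact absurd rfl hqq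
      · exact hdisj
      · exact hdisj.symm
      · exact absurd rfl hqq
    · rw [Finset.sum_pair hne]
      linarith
    · rw [Finset.sum_pair hne]
      simp only
      linarith
  · obtain ⟨l1, l2, -⟩ := left hl
    have l3 := (leftEnd hl).1
    refine ⟨{(c, x₁)}, ?_, by simp, ?_, ?_⟩
    · intro q hq
      rw [Finset.mem_singleton.1 hq]
      exact ⟨l1, le_rfl, h2.trans h3⟩
    · rw [Finset.sum_singleton]
      linarith
    · rw [Finset.sum_singleton]
      simp only
      linarith
  · obtain ⟨r1, r2, -⟩ := right hr
    have r3 := (rightEnd hr).1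
    refine ⟨{(x₂, d)}, ?_, by simp, ?_, ?_⟩
    · intro q hq
      rw [Finset.mem_singleton.1 hq]
      exact ⟨r1, h1.trans h2, le_rfl⟩
    · rw [Finset.sum_singleton]
      linarith
    · rw [Finset.sum_singleton]
      simp only
      linarith
  · refine ⟨∅, by simp, by simp, ?_, ?_⟩
    · rw [Finset.sum_empty]
      linarith
    · rw [Finset.sum_empty]
      linarith

/-- Iterating `exists_children`. -/
lemma exists_pieces (hf : IsLorenzMap f lam B β) {N ε τ δ a : ℝ} {R r : ℝ → ℝ}
    (hN : 0 ≤ N) (hε : 0 ≤ ε)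
    (hR : ∀ y ∈ puncturedInterior, HasDerivAt R (r y) y ∧ 0 ≤ r y ∧
      |R y| ≤ ε ∧ B * |y| ^ (-β) ≤ N + r y) (hδ : 0 < δ) (hτ : 0 ≤ τ)
    (hδτ : ∀ y ∈ puncturedInterior, |y| ≤ δ → (deriv f y)⁻¹ ≤ τ) {u v : ℝ} (hu : -1 / 2 < u)
    (huv : u < v) (hv : v < 1 / 2) (ha : 0 < a) (hδa : δ * a ≤ 1) (ha1 : 2 ≤ a * (v - u))
    (ha2 : (lam⁻¹ + τ + 2 * ε) * a + N ≤ a * (1 - δ * a)) (n : ℕ) :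
    ∃ S : Finset (ℝ × ℝ), (∀ q ∈ S, IsPiece f δ n q ∧ u ≤ q.1 ∧ q.2 ≤ v) ∧
      (S : Set (ℝ × ℝ)).PairwiseDisjoint (fun q => Icc q.1 q.2) ∧
      ∑ q ∈ S, pieceVar f n q ≤ a * ∑ q ∈ S, (q.2 - q.1) ∧
      (1 - δ * a) ^ n * (v - u) ≤ ∑ q ∈ S, (q.2 - q.1) := by
  -- Invariant: total variation is at most a times total length. The length lost in a step is then
  -- at most δa times the total, and `ha2` restores the invariant for the shorter total.
  induction n with
  | zero =>
    refine ⟨{(u, v)}, ?_, by simp, ?_, ?_⟩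
    · intro q hq
      rw [Finset.mem_singleton.1 hq]
      exact ⟨⟨huv, hu, hv, fun x _ i hi => absurd hi (Nat.not_lt_zero i)⟩, le_rfl, le_rfl⟩
    -- The constant weight 1 has variation 2, which `ha1` absorbs.
    · have h0 : orbitWeight f 0 = fun _ => 1 := by ext x; simp [orbitWeight]
      simp only [Finset.sum_singleton, pieceVar, h0]
      simp
      linarith
    · simp
  | succ n ih =>
    obtain ⟨S, hS1, hS2, hS3, hS4⟩ := ih
    have hch := fun q : S => hf.exists_children hN hε hR hδ hτ hδτ (hS1 q.1 q.2).1
    choose T hT1 hT2 hT3 hT4 using hch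
    have hdisj : (S.attach : Set S).PairwiseDisjoint T := by
      intro q _ q' _ hqq
      rw [Function.onFun, Finset.disjoint_left]
      intro t ht ht'
      have e1 := hT1 q t ht
      have e2 := hT1 q' t ht'
      have := hS2 q.2 q'.2 (fun h => hqq (Subtype.ext h))
      exact Set.disjoint_left.1 this ⟨e1.2.1, e1.1.lt.le.trans e1.2.2⟩
        ⟨e2.2.1, e2.1.lt.le.trans e2.2.2⟩
    have hV : ∑ q ∈ S.attach.biUnion T, pieceVar f (n + 1) q ≤
        (lam⁻¹ + τ + 2 * ε) * ∑ q ∈ S, pieceVar f n q + N * ∑ q ∈ S, (q.2 - q.1) := by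
      rw [Finset.sum_biUnion hdisj, ← Finset.sum_attach S (fun q => pieceVar f n q),
        ← Finset.sum_attach S (fun q => q.2 - q.1), Finset.mul_sum, Finset.mul_sum,
        ← Finset.sum_add_distrib]
      exact Finset.sum_le_sum fun q _ => hT3 q
    have hZ : ∑ q ∈ S, (q.2 - q.1) - δ * ∑ q ∈ S, pieceVar f n q ≤
        ∑ q ∈ S.attach.biUnion T, (q.2 - q.1) := by
      rw [Finset.sum_biUnion hdisj, ← Finset.sum_attach S (fun q => pieceVar f n q),
        ← Finset.sum_attach S (fun q => q.2 - q.1), Finset.mul_sum,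
        ← Finset.sum_sub_distrib]
      exact Finset.sum_le_sum fun q _ => hT4 q
    set Z := ∑ q ∈ S, (q.2 - q.1) with hZdef
    set W := ∑ q ∈ S, pieceVar f n q with hWdef
    have hZ0 : 0 ≤ Z := Finset.sum_nonneg fun q hq => by linarith [(hS1 q hq).1.lt]
    have hθ : 0 ≤ lam⁻¹ + τ + 2 * ε := by
      have : 0 < lam⁻¹ := inv_pos.2 (by linarith [hf.one_lt])
      linarith
    have hZ' : (1 - δ * a) * Z ≤ ∑ q ∈ S.attach.biUnion T, (q.2 - q.1) := by
      have : δ * W ≤ δ * (a * Z) := by gcongr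
      linarith
    refine ⟨S.attach.biUnion T, ?_, ?_, ?_, ?_⟩
    · intro t ht
      obtain ⟨q, -, hq⟩ := Finset.mem_biUnion.1 ht
      have e1 := hT1 q t hq
      have e2 := hS1 q.1 q.2
      exact ⟨e1.1, e2.2.1.trans e1.2.1, e1.2.2.trans e2.2.2⟩
    · intro t ht t' ht' htt
      obtain ⟨q, -, hq⟩ := Finset.mem_biUnion.1 (Finset.mem_coe.1 ht)
      obtain ⟨q', -, hq'⟩ := Finset.mem_biUnion.1 (Finset.mem_coe.1 ht')
      by_cases h : q = q'
      · subst h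
        exact hT2 q hq hq' htt
      · have e1 := hT1 q t hq
        have e2 := hT1 q' t' hq'
        have := hS2 q.2 q'.2 (fun hh => h (Subtype.ext hh))
        exact this.mono (Icc_subset_Icc e1.2.1 e1.2.2) (Icc_subset_Icc e2.2.1 e2.2.2)
    · calc ∑ q ∈ S.attach.biUnion T, pieceVar f (n + 1) q
          ≤ (lam⁻¹ + τ + 2 * ε) * W + N * Z := hV
        _ ≤ (lam⁻¹ + τ + 2 * ε) * (a * Z) + N * Z := by gcongr
        _ = ((lam⁻¹ + τ + 2 * ε) * a + N) * Z := by ring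
        _ ≤ (a * (1 - δ * a)) * Z := by gcongr
        _ = a * ((1 - δ * a) * Z) := by ring
        _ ≤ _ := by gcongr
    · calc (1 - δ * a) ^ (n + 1) * (v - u) = (1 - δ * a) * ((1 - δ * a) ^ n * (v - u)) := by ring
        _ ≤ (1 - δ * a) * Z := by
          have : 0 ≤ 1 - δ * a := by linarith
          gcongr
        _ ≤ _ := hZ'

/-- Most of an interval stays away from a small hole for a long time, and most of what stays lies
in intervals with long images. -/
lemma exists_long_pieces (hf : IsLorenzMap f lam B β) {u v : ℝ} (hu : -1 / 2 < u)
    (huv : u < v) (hv : v < 1 / 2) :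
    ∃ ℓ > 0, ∀ η > 0, η < 1 → ∃ δ > 0, ∀ n : ℕ, ∃ S : Finset (ℝ × ℝ),
      (∀ q ∈ S, IsPiece f δ n q ∧ u ≤ q.1 ∧ q.2 ≤ v ∧ ℓ ≤ f^[n] q.2 - f^[n] q.1) ∧
      (S : Set (ℝ × ℝ)).PairwiseDisjoint (fun q => Icc q.1 q.2) ∧
      (1 - η) ^ n * (v - u) / 2 ≤ ∑ q ∈ S, (q.2 - q.1) := by
  have hl := hf.one_lt
  have hl1 : lam⁻¹ < 1 := inv_lt_one_of_one_lt₀ hl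
  set ω := 1 - lam⁻¹ with hω
  have hω0 : 0 < ω := by linarith
  obtain ⟨N, R, r, hN, hR⟩ := exists_small_primitive hf.pos_bound hf.pos_exponent
    hf.exponent_lt_one (by positivity : 0 < ω / 8)
  obtain ⟨δ₀, hδ₀, hδ₀τ⟩ := hf.inv_deriv_small (ω / 4) (by positivity)
  have hvu : 0 < v - u := by linarith
  -- The first term starts the induction; the second gives N ≤ ωa/4. The Lasota–Yorke coefficient is
  -- λ⁻¹ + ω/4 + 2·ω/8 = 1 - ω/2, so δa ≤ ω/4 closes it. As a is fixed before η, so is ℓ = 1/a.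
  set a := 2 / (v - u) + 4 * N / ω with ha
  have ha0 : 0 < a := by positivity
  have ha1 : 2 ≤ a * (v - u) := by
    rw [ha, add_mul, div_mul_cancel₀ _ hvu.ne']
    have : 0 ≤ 4 * N / ω * (v - u) := by positivity
    linarith
  have ha2 : N ≤ ω / 4 * a := by
    rw [ha, mul_add]
    have e1 : ω / 4 * (4 * N / ω) = N := by field_simp
    have : 0 ≤ ω / 4 * (2 / (v - u)) := by positivity
    linarith
  refine ⟨1 / a, by positivity, fun η hη hη1 => ?_⟩
  set δ := min δ₀ (min (η / a) (ω / 4 / a)) with hδ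
  have hδ0 : 0 < δ := by positivity
  have d1 : δ * a ≤ η := by
    rw [← le_div_iff₀ ha0]; exact (min_le_right _ _).trans (min_le_left _ _)
  have d2 : δ * a ≤ ω / 4 := by
    rw [← le_div_iff₀ ha0]; exact (min_le_right _ _).trans (min_le_right _ _)
  refine ⟨δ, hδ0, fun n => ?_⟩
  obtain ⟨S, hS1, hS2, hS3, hS4⟩ := hf.exists_pieces (τ := ω / 4) (a := a) hN (by positivity) hR hδ0
    (by positivity) (fun y hy hy' => hδ₀τ y hy (hy'.trans (min_le_left _ _))) hu huv hv ha0
    (by linarith) ha1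
    (by
      have : a * (δ * a) ≤ a * (ω / 4) := by gcongr
      have : lam⁻¹ = 1 - ω := by rw [hω]; ring
      rw [this]
      nlinarith) n
  refine ⟨S.filter fun q => 1 / a ≤ f^[n] q.2 - f^[n] q.1, ?_, ?_, ?_⟩
  · intro q hq
    obtain ⟨hq1, hq2⟩ := Finset.mem_filter.1 hq
    exact ⟨(hS1 q hq1).1, (hS1 q hq1).2.1, (hS1 q hq1).2.2, hq2⟩
  · exact hS2.subset fun q hq => (Finset.mem_filter.1 (Finset.mem_coe.1 hq)).1
  · have hsplit := Finset.sum_filter_add_sum_filter_not S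
      (fun q : ℝ × ℝ => 1 / a ≤ f^[n] q.2 - f^[n] q.1) (fun q => q.2 - q.1)
    -- A piece with image shorter than 1/a has length at most its variation divided by 2a, and the
    -- total variation is at most a times the total length.
    have hsmall : ∑ q ∈ S.filter fun q => ¬ 1 / a ≤ f^[n] q.2 - f^[n] q.1, (q.2 - q.1) ≤
        (∑ q ∈ S, (q.2 - q.1)) / 2 := by
      calc _ ≤ ∑ q ∈ S.filter fun q => ¬ 1 / a ≤ f^[n] q.2 - f^[n] q.1,
            pieceVar f n q * (1 / (2 * a)) := by
            refine Finset.sum_le_sum fun q hq => ?_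
            obtain ⟨hq1, hq2⟩ := Finset.mem_filter.1 hq
            have hqp := (hS1 q hq1).1
            have hqs := hf.subset_orbitDomain hδ0 hqp
            have hV0 := hf.pieceVar_nonneg hqp.lt.le hqs
            have := hf.sub_le_mul (m := pieceVar f n q / 2) hqp.lt.le hqs (fun x hx => by
              have := hf.two_mul_orbitWeight_le hqs hx
              linarith)
            push Not at hq2
            calc q.2 - q.1 ≤ pieceVar f n q / 2 * (f^[n] q.2 - f^[n] q.1) := this
              _ ≤ pieceVar f n q / 2 * (1 / a) := by gcongr
              _ = _ := by field_simp
        _ ≤ ∑ q ∈ S, pieceVar f n q * (1 / (2 * a)) := by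
            refine Finset.sum_le_sum_of_subset_of_nonneg (Finset.filter_subset _ _)
              fun q hq _ => ?_
            have hqp := (hS1 q hq).1
            have := hf.pieceVar_nonneg hqp.lt.le (hf.subset_orbitDomain hδ0 hqp)
            positivity
        _ = (∑ q ∈ S, pieceVar f n q) * (1 / (2 * a)) := by rw [Finset.sum_mul]
        _ ≤ (a * ∑ q ∈ S, (q.2 - q.1)) * (1 / (2 * a)) := by gcongr
        _ = _ := by field_simp
    have hpow : (1 - η) ^ n * (v - u) ≤ (1 - δ * a) ^ n * (v - u) := by
      have : 0 ≤ 1 - η := by linarith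
      gcongr
    linarith

end IsLorenzMap

/-! ### Bounded distortion and abundance of full branches. -/

/-- An interval mapped diffeomorphically onto `[1/8, 1/4]` by an iterate of `f`. -/
structure FullBranch (f : ℝ → ℝ) where
  left : ℝ
  right : ℝ
  time : ℕ
  lt : left < right
  one_le_time : 1 ≤ time
  subset : Icc left right ⊆ orbitDomain f time
  map_left : f^[time] left = 1 / 8
  map_right : f^[time] right = 1 / 4

/-- The interval on which a full branch is defined. -/
def FullBranch.interval {f : ℝ → ℝ} (t : FullBranch f) : Set ℝ := Icc t.left t.right

namespace IsLorenzMap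

variable {f : ℝ → ℝ} {lam B β : ℝ}

lemma mul_abs_sub_le (hf : IsLorenzMap f lam B β) {x y : ℝ} (h : uIcc x y ⊆ puncturedInterior) :
    lam * |x - y| ≤ |f x - f y| := by
  wlog hxy : x ≤ y generalizing x y
  · rw [abs_sub_comm x, abs_sub_comm (f x)]
    exact this (by rwa [uIcc_comm]) (le_of_not_ge hxy)
  rw [uIcc_of_le hxy] at h
  rw [abs_sub_comm x, abs_sub_comm (f x), abs_of_nonneg (by linarith : 0 ≤ y - x)]
  exact (hf.mul_sub_le hxy h).trans (le_abs_self _)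

/-- Away from the singularity the derivative of `f` has bounded distortion. -/
lemma exists_inv_deriv_le_mul_exp (hf : IsLorenzMap f lam B β) {δ : ℝ} (hδ : 0 < δ) :
    ∃ L ≥ 0, ∀ x y, (∀ z ∈ uIcc x y, z ∈ puncturedInterior ∧ δ ≤ |z|) →
      (deriv f y)⁻¹ ≤ (deriv f x)⁻¹ * Real.exp (L * |x - y|) := by
  obtain ⟨M₀, hM₀⟩ := hf.deriv_bdd δ hδ
  set M := max M₀ 1 with hM
  have hB := hf.pos_bound
  refine ⟨B * δ ^ (-β) * M, by positivity, fun x y h => ?_⟩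
  have hx := h x left_mem_uIcc
  have h1 : ‖(deriv f y)⁻¹ - (deriv f x)⁻¹‖ ≤ B * δ ^ (-β) * ‖y - x‖ := by
    refine (convex_uIcc x y).norm_image_sub_le_of_norm_hasDerivWithin_le
      (f := fun z => (deriv f z)⁻¹) (f' := fun z => deriv (fun w => (deriv f w)⁻¹) z)
      (fun z hz => ?_) (fun z hz => ?_) left_mem_uIcc right_mem_uIcc
    · exact ((hf.contDiffOn_inv_deriv.contDiffAt
        (isOpen_puncturedInterior.mem_nhds (h z hz).1)).differentiableAt
        (by norm_num)).hasDerivAt.hasDerivWithinAt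
    · refine (hf.abs_deriv_inv_le z (h z hz).1).trans ?_
      have := Real.rpow_le_rpow_of_nonpos hδ (h z hz).2 (by linarith [hf.pos_exponent] : -β ≤ 0)
      gcongr
  have hp := hf.deriv_pos hx.1
  -- The upper bound on f' away from 0 turns an additive estimate into a multiplicative one.
  have h2 : 1 ≤ (deriv f x)⁻¹ * M := by
    rw [inv_mul_eq_div, one_le_div hp]
    exact (hM₀ x hx.1 hx.2).trans (le_max_left _ _)
  have h3 : (deriv f y)⁻¹ ≤ (deriv f x)⁻¹ + B * δ ^ (-β) * |x - y| := by
    rw [Real.norm_eq_abs, Real.norm_eq_abs, abs_sub_comm y x] at h1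
    linarith [le_abs_self ((deriv f y)⁻¹ - (deriv f x)⁻¹)]
  have h4 := Real.add_one_le_exp (B * δ ^ (-β) * M * |x - y|)
  have h5 : 0 ≤ B * δ ^ (-β) * |x - y| := by positivity
  calc (deriv f y)⁻¹ ≤ (deriv f x)⁻¹ + (B * δ ^ (-β) * |x - y|) * 1 := by linarith
    _ ≤ (deriv f x)⁻¹ + (B * δ ^ (-β) * |x - y|) * ((deriv f x)⁻¹ * M) := by gcongr
    _ = (deriv f x)⁻¹ * (B * δ ^ (-β) * M * |x - y| + 1) := by ring
    _ ≤ _ := by gcongr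

/-- Iterates of `f` have uniformly bounded distortion on intervals that avoid a hole around the
singularity. -/
lemma exists_inv_orbitWeight_le (hf : IsLorenzMap f lam B β) {δ : ℝ} (hδ : 0 < δ) :
    ∃ D > 0, ∀ n p, IsPiece f δ n p → ∀ x ∈ Icc p.1 p.2,
      (orbitWeight f n x)⁻¹ ≤ D / (p.2 - p.1) := by
  obtain ⟨L, hL, hLxy⟩ := hf.exists_inv_deriv_le_mul_exp hδ
  have hl := hf.one_lt
  -- The sum of L λ^(-j) over j ≥ 1. Measured against the distance of the final images, earlier
  -- distortions form this geometric series, hence the fixed-point relation L + L' = λL'.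
  set L' := L / (lam - 1) with hL'
  have hL'0 : 0 ≤ L' := div_nonneg hL (by linarith)
  have hrec : L + L' = L' * lam := by
    rw [hL']; field_simp [(by linarith : lam - 1 ≠ 0)]; ring
  have claim : ∀ n p, IsPiece f δ n p → ∀ x ∈ Icc p.1 p.2, ∀ y ∈ Icc p.1 p.2,
      orbitWeight f n y ≤ orbitWeight f n x * Real.exp (L' * |f^[n] x - f^[n] y|) := by
    intro n p
    induction n with
    | zero =>
      intro _ x _ y _
      simp only [orbitWeight, Finset.range_zero, Finset.prod_empty, one_mul]
      exact Real.one_le_exp (by positivity)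
    | succ n ih =>
      intro hp x hx y hy
      have hp' : IsPiece f δ n p :=
        ⟨hp.lt, hp.left_gt, hp.right_lt, fun z hz i hi => hp.le_abs z hz i (by omega)⟩
      have hs := hf.subset_orbitDomain hδ hp
      have hs' := hf.subset_orbitDomain hδ hp'
      have himg : uIcc (f^[n] x) (f^[n] y) ⊆ f^[n] '' Icc p.1 p.2 := by
        have hi := hf.image_iterate_Icc hp.lt.le hs'
        rw [hi]
        have e1 : f^[n] x ∈ Icc (f^[n] p.1) (f^[n] p.2) := hi ▸ mem_image_of_mem _ hx
        have e2 : f^[n] y ∈ Icc (f^[n] p.1) (f^[n] p.2) := hi ▸ mem_image_of_mem _ hy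
        exact uIcc_subset_Icc e1 e2
      have hgood : ∀ z ∈ uIcc (f^[n] x) (f^[n] y), z ∈ puncturedInterior ∧ δ ≤ |z| := by
        intro z hz
        obtain ⟨w, hw, rfl⟩ := himg hz
        exact ⟨hs hw n (Nat.lt_succ_self n), hp.le_abs w hw n (Nat.lt_succ_self n)⟩
      have h1 := ih hp' x hx y hy
      have h2 := hLxy _ _ hgood
      have h3 := hf.mul_abs_sub_le (fun z hz => (hgood z hz).1)
      have q1 := hf.orbitWeight_pos (hs' hx)
      have q3 := inv_pos.2 (hf.deriv_pos (hgood _ right_mem_uIcc).1)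
      rw [orbitWeight_succ, orbitWeight_succ, Function.iterate_succ_apply',
        Function.iterate_succ_apply']
      calc _ ≤ (orbitWeight f n x * Real.exp (L' * |f^[n] x - f^[n] y|)) *
            ((deriv f (f^[n] x))⁻¹ * Real.exp (L * |f^[n] x - f^[n] y|)) :=
            mul_le_mul h1 h2 q3.le (by positivity)
        _ = orbitWeight f n x * (deriv f (f^[n] x))⁻¹ *
            Real.exp (L' * (lam * |f^[n] x - f^[n] y|)) := by
            rw [← mul_assoc L', ← hrec, add_mul, Real.exp_add]; ring
        _ ≤ _ := by
            have := inv_pos.2 (hf.deriv_pos (hgood _ left_mem_uIcc).1)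
            gcongr
  refine ⟨Real.exp L', Real.exp_pos _, fun n p hp x hx => ?_⟩
  have hs := hf.subset_orbitDomain hδ hp
  obtain ⟨ξ, hξ, h1⟩ := hf.exists_iterate_sub_eq hp.lt hs
  have hξ' := Ioo_subset_Icc_self hξ
  have hio : ∀ z ∈ Icc p.1 p.2, f^[n] z ∈ Ioo (-1 / 2 : ℝ) (1 / 2) := fun z hz =>
    hf.iterate_mem_Ioo ⟨hp.left_gt.trans_le hz.1, hz.2.trans_lt hp.right_lt⟩ (hs hz)
  have c1 := claim n p hp x hx ξ hξ'
  have w1 := hf.orbitWeight_pos (hs hx)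
  have w2 := hf.orbitWeight_pos (hs hξ')
  have c2 : orbitWeight f n ξ ≤ orbitWeight f n x * Real.exp L' := by
    refine c1.trans ?_
    have e1 := hio x hx
    have e2 := hio ξ hξ'
    have : |f^[n] x - f^[n] ξ| ≤ 1 := by
      rw [abs_le]; constructor <;> linarith [e1.1, e1.2, e2.1, e2.2]
    have : L' * |f^[n] x - f^[n] ξ| ≤ L' * 1 := by gcongr
    gcongr
    linarith
  have hlen : (orbitWeight f n ξ)⁻¹ * (p.2 - p.1) ≤ 1 := by
    rw [← h1]
    linarith [(hio p.1 (left_mem_Icc.2 hp.lt.le)).1, (hio p.2 (right_mem_Icc.2 hp.lt.le)).2]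
  have hpos : 0 < p.2 - p.1 := by linarith [hp.lt]
  rw [inv_mul_eq_div, div_le_one w2] at hlen
  rw [le_div_iff₀ hpos, inv_mul_le_iff₀ w1]
  linarith

/-- Finitely many full branches in a given interval, the contractions of whose inverses are weak
enough for the dimension `s`. -/
lemma exists_branches (hf : IsLorenzMap f lam B β) {u v s : ℝ} (hu : -1 / 2 < u)
    (huv : u < v) (hv : v < 1 / 2) (hs1 : s < 1) :
    ∃ (ι : Type) (_ : Fintype ι) (b : ι → FullBranch f) (κ : ι → ℝ),
      (∀ i, u ≤ (b i).left ∧ (b i).right ≤ v) ∧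
      (Pairwise fun i j => Disjoint (b i).interval (b j).interval) ∧
      (∀ i, 0 < κ i ∧ ∀ x ∈ (b i).interval, ∀ y ∈ (b i).interval,
        κ i * |f^[(b i).time] x - f^[(b i).time] y| ≤ |x - y|) ∧
      1 ≤ ∑ i, κ i ^ s := by
  have hl := hf.one_lt
  obtain ⟨ℓ, hℓ, hlong⟩ := hf.exists_long_pieces hu huv hv
  obtain ⟨M, hM, hreach⟩ := hf.exists_uniform_reaches hℓ
  -- A piece with |p| ≤ λ⁻ⁿ satisfies |p|^s ≥ ρⁿ|p|. The escape rate η = (1 - ρ⁻¹)/2 chosen below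
  -- makes ρ(1 - η) = (ρ + 1)/2 > 1. The constants D and M do not depend on n, so n can be chosen
  -- last.
  set ρ := lam ^ (1 - s) with hρ
  have hρ1 : 1 < ρ := Real.one_lt_rpow hl (by linarith)
  have hρ0 : 0 < ρ := by linarith
  have hρi : ρ⁻¹ < 1 := inv_lt_one_of_one_lt₀ hρ1
  have hρi0 : 0 < ρ⁻¹ := inv_pos.2 hρ0
  obtain ⟨δ, hδ, hS⟩ := hlong ((1 - ρ⁻¹) / 2) (by linarith) (by linarith)
  obtain ⟨D, hD, hdist⟩ := hf.exists_inv_orbitWeight_le hδ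
  have hvu : 0 < v - u := by linarith
  set A := (M * D) ^ (-s) * ((v - u) / 2) with hA
  have hA0 : 0 < A := by positivity
  obtain ⟨n₀, hn₀⟩ := pow_unbounded_of_one_lt (1 / A) (by linarith : 1 < (ρ + 1) / 2)
  -- The extra step guarantees that branch times are positive.
  obtain ⟨n, hn⟩ : ∃ n, n = n₀ + 1 := ⟨_, rfl⟩
  have hnA : 1 ≤ ((ρ + 1) / 2) ^ n * A := by
    rw [div_lt_iff₀ hA0] at hn₀
    rw [hn, pow_succ]
    have : ((ρ + 1) / 2) ^ n₀ * A ≤ ((ρ + 1) / 2) ^ n₀ * ((ρ + 1) / 2) * A := by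
      have : ((ρ + 1) / 2) ^ n₀ * 1 ≤ ((ρ + 1) / 2) ^ n₀ * ((ρ + 1) / 2) := by
        gcongr; linarith
      rw [mul_one] at this
      gcongr
    linarith
  obtain ⟨S, hS1, hS2, hS3⟩ := hS n
  -- After n steps, with derivative at most D/|q|, the long image contains an interval sent onto
  -- [1/8, 1/4] with Lipschitz constant M.
  have hbr : ∀ q : S, ∃ t : FullBranch f, q.1.1 ≤ t.left ∧ t.right ≤ q.1.2 ∧
      ∀ x ∈ t.interval, ∀ y ∈ t.interval,
        (q.1.2 - q.1.1) / (M * D) * |f^[t.time] x - f^[t.time] y| ≤ |x - y| := by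
    intro q
    obtain ⟨hq, hq1, hq2, hq3⟩ := hS1 q.1 q.2
    have hqs := hf.subset_orbitDomain hδ hq
    have hio : ∀ z ∈ Icc q.1.1 q.1.2, f^[n] z ∈ Ioo (-1 / 2 : ℝ) (1 / 2) := fun z hz =>
      hf.iterate_mem_Ioo ⟨hq.left_gt.trans_le hz.1, hz.2.trans_lt hq.right_lt⟩ (hqs hz)
    obtain ⟨c', d', k, r1, r2, r3, r4, r5, r6, r7⟩ := hreach _ _
      (hio _ (left_mem_Icc.2 hq.lt.le)).1 (hio _ (right_mem_Icc.2 hq.lt.le)).2 hq3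
    obtain ⟨c, d, hc, hcd, hd, rfl, rfl⟩ := hf.exists_pullback hq.lt.le hqs r1 r2 r3
    have hsub : Icc c d ⊆ Icc q.1.1 q.1.2 := Icc_subset_Icc hc hd
    refine ⟨⟨c, d, n + k, hcd, by omega,
      hf.subset_orbitDomain_add hcd.le (hsub.trans hqs) r4,
      by rwa [add_comm, Function.iterate_add_apply],
      by rwa [add_comm, Function.iterate_add_apply]⟩, hc, hd, fun x hx y hy => ?_⟩
    change x ∈ Icc c d at hx
    change y ∈ Icc c d at hy
    have hpos : 0 < q.1.2 - q.1.1 := by linarith [hq.lt]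
    have e1 : ‖f^[n] x - f^[n] y‖ ≤ D / (q.1.2 - q.1.1) * ‖x - y‖ := by
      refine (convex_Icc q.1.1 q.1.2).norm_image_sub_le_of_norm_hasDerivWithin_le
        (fun z hz => (hf.hasDerivAt_iterate (hqs hz)).hasDerivWithinAt) (fun z hz => ?_)
        (hsub hy) (hsub hx)
      rw [Real.norm_eq_abs, abs_of_pos (inv_pos.2 (hf.orbitWeight_pos (hqs hz)))]
      exact hdist n q.1 hq z hz
    have himg := hf.image_iterate_Icc hcd.le (hsub.trans hqs)
    have e2 := r7 (f^[n] x) (himg ▸ mem_image_of_mem _ hx) (f^[n] y)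
      (himg ▸ mem_image_of_mem _ hy)
    simp only [Real.norm_eq_abs] at e1
    simp only
    rw [add_comm n k, Function.iterate_add_apply, Function.iterate_add_apply]
    calc (q.1.2 - q.1.1) / (M * D) * |f^[k] (f^[n] x) - f^[k] (f^[n] y)|
        ≤ (q.1.2 - q.1.1) / (M * D) * (M * (D / (q.1.2 - q.1.1) * |x - y|)) := by
          gcongr
          exact e2.trans (by gcongr)
      _ = |x - y| := by field_simp
  choose b hb1 hb2 hb3 using hbr
  refine ⟨S, inferInstance, b, fun q => (q.1.2 - q.1.1) / (M * D), fun q => ?_, ?_, fun q => ?_, ?_⟩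
  · obtain ⟨-, h1, h2, -⟩ := hS1 q.1 q.2
    exact ⟨h1.trans (hb1 q), (hb2 q).trans h2⟩
  · intro q q' hqq
    have := hS2 q.2 q'.2 (fun h => hqq (Subtype.ext h))
    exact this.mono (Icc_subset_Icc (hb1 q) (hb2 q)) (Icc_subset_Icc (hb1 q') (hb2 q'))
  · have : 0 < q.1.2 - q.1.1 := by linarith [(hS1 q.1 q.2).1.lt]
    exact ⟨by positivity, hb3 q⟩
  · have hterm : ∀ q ∈ S, (M * D) ^ (-s) * (ρ ^ n * (q.2 - q.1)) ≤
        ((q.2 - q.1) / (M * D)) ^ s := by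
      intro q hq
      have hqp := (hS1 q hq).1
      have hqs := hf.subset_orbitDomain hδ hqp
      have hio : ∀ z ∈ Icc q.1 q.2, f^[n] z ∈ Ioo (-1 / 2 : ℝ) (1 / 2) := fun z hz =>
        hf.iterate_mem_Ioo ⟨hqp.left_gt.trans_le hz.1, hz.2.trans_lt hqp.right_lt⟩ (hqs hz)
      have hpos : 0 < q.2 - q.1 := by linarith [hqp.lt]
      have hlen : q.2 - q.1 ≤ (lam ^ n)⁻¹ := by
        have e1 := hf.pow_mul_sub_le hqp.lt.le hqs
        have e2 := (hio _ (left_mem_Icc.2 hqp.lt.le)).1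
        have e3 := (hio _ (right_mem_Icc.2 hqp.lt.le)).2
        rw [← one_div, le_div_iff₀ (by positivity)]
        linarith
      have hpow : ρ ^ n ≤ (q.2 - q.1) ^ (s - 1) := by
        have e1 := Real.rpow_le_rpow_of_nonpos hpos hlen (by linarith : s - 1 ≤ 0)
        have e2 : ((lam ^ n)⁻¹ : ℝ) ^ (s - 1) = ρ ^ n := by
          rw [Real.inv_rpow (by positivity), ← Real.rpow_neg (by positivity), hρ,
            ← Real.rpow_natCast, ← Real.rpow_natCast, ← Real.rpow_mul (by positivity),
            ← Real.rpow_mul (by positivity)]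
          congr 1; ring
        rwa [e2] at e1
      have hsplit : (q.2 - q.1) ^ s = (q.2 - q.1) ^ (s - 1) * (q.2 - q.1) := by
        rw [← Real.rpow_add_one hpos.ne']; congr 1; ring
      rw [Real.div_rpow hpos.le (by positivity), div_eq_mul_inv, ← Real.rpow_neg (by positivity),
        mul_comm, hsplit]
      gcongr
    rw [Finset.sum_coe_sort S (fun q => ((q.2 - q.1) / (M * D)) ^ s)]
    refine le_trans ?_ (Finset.sum_le_sum hterm)
    rw [← Finset.mul_sum, ← Finset.mul_sum]
    have e1 : (ρ + 1) / 2 = ρ * (1 - (1 - ρ⁻¹) / 2) := by field_simp; ring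
    calc (1 : ℝ) ≤ ((ρ + 1) / 2) ^ n * A := hnA
      _ = (M * D) ^ (-s) * (ρ ^ n * ((1 - (1 - ρ⁻¹) / 2) ^ n * (v - u) / 2)) := by
        rw [e1, mul_pow, hA]; ring
      _ ≤ _ := by gcongr

end IsLorenzMap

/-! ### Hausdorff dimension of sets invariant under separated contractions. -/

/-- Consecutive half-open intervals of given lengths. -/
lemma exists_cover_of_lengths {ι : Type*} (p : ι → ℝ) (S : Finset ι) :
    ∃ P : ι → ℝ, ∀ t, 0 ≤ t → t < ∑ i ∈ S, p i → ∃ i ∈ S, P i ≤ t ∧ t < P i + p i := by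
  classical
  induction S using Finset.induction_on with
  | empty => exact ⟨0, fun t h0 h1 => by simp at h1; linarith⟩
  | insert a S ha ih =>
    obtain ⟨P, hP⟩ := ih
    refine ⟨Function.update P a (∑ i ∈ S, p i), fun t h0 h1 => ?_⟩
    by_cases h : t < ∑ i ∈ S, p i
    · obtain ⟨i, hi, h2⟩ := hP t h0 h
      have hia : i ≠ a := fun h => ha (h ▸ hi)
      exact ⟨i, Finset.mem_insert_of_mem hi, by rwa [Function.update_of_ne hia]⟩
    · refine ⟨a, Finset.mem_insert_self _ _, ?_⟩
      rw [Function.update_self]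
      rw [Finset.sum_insert ha] at h1
      exact ⟨not_lt.1 h, by linarith⟩

/-- If `z` maps `[0, 1)` into `K` and its inverse is Hölder with exponent `s`, then the Hausdorff
dimension of `K` is at least `s`. -/
lemma le_dimH_of_inverse_holder {K : Set ℝ} {H s : ℝ} (hs : 0 < s) (z : Ico (0 : ℝ) 1 → ℝ)
    (hzK : ∀ t, z t ∈ K) (hz : ∀ t t' : Ico (0 : ℝ) 1, |(t : ℝ) - t'| ≤ H * |z t - z t'| ^ s) :
    ENNReal.ofReal s ≤ dimH K := by
  have hinj : Function.Injective z := by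
    intro t t' h
    have := hz t t'
    rw [h, sub_self, abs_zero, Real.zero_rpow hs.ne', mul_zero] at this
    exact Subtype.ext (by linarith [abs_nonpos_iff.1 this])
  have : Nonempty (Ico (0 : ℝ) 1) := ⟨⟨0, by simp⟩⟩
  set h : ℝ → ℝ := fun y => ((Function.invFun z y : Ico (0 : ℝ) 1) : ℝ) with hh
  have hhz : ∀ t, h (z t) = t := fun t => by
    rw [hh]; exact congrArg _ (Function.leftInverse_invFun hinj t)
  have hholder : HolderOnWith H.toNNReal s.toNNReal h (range z) := by
    rintro _ ⟨t, rfl⟩ _ ⟨t', rfl⟩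
    rw [hhz, hhz, edist_dist, edist_dist, Real.coe_toNNReal s hs.le,
      ENNReal.ofReal_rpow_of_nonneg dist_nonneg hs.le, ← ENNReal.ofReal_coe_nnreal,
      ← ENNReal.ofReal_mul (NNReal.coe_nonneg _), Real.dist_eq, Real.dist_eq]
    apply ENNReal.ofReal_le_ofReal
    refine (hz t t').trans ?_
    gcongr
    exact Real.le_coe_toNNReal H
  have himg : h '' range z = Ico 0 1 := by
    rw [← range_comp]
    ext y
    constructor
    · rintro ⟨t, rfl⟩
      simp only [Function.comp, hhz]
      exact t.2
    · intro hy
      exact ⟨⟨y, hy⟩, by simp only [Function.comp, hhz]⟩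
  have hdim := hholder.dimH_image_le (by simpa using hs)
  rw [himg, Real.dimH_of_nonempty_interior ⟨1 / 2, by rw [interior_Ico]; norm_num⟩] at hdim
  have h1 := ENNReal.mul_le_of_le_div hdim
  rw [Module.finrank_self, Nat.cast_one, one_mul] at h1
  exact h1.trans (dimH_mono (by rintro _ ⟨t, rfl⟩; exact hzK t))

/-- Lower bound of the Hausdorff dimension of a set invariant under separated contractions. -/
lemma le_dimH_of_contractions {ι : Type*} [Fintype ι] {K : Set ℝ} (hK : IsClosed K)
    (hdiam : ∀ x ∈ K, ∀ y ∈ K, |x - y| ≤ 1) (hne : K.Nonempty) (g : ι → ℝ → ℝ)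
    (hgK : ∀ i, MapsTo (g i) K K) {ρ γ s : ℝ} {κ : ι → ℝ} (hρ : ρ < 1) (hγ : 0 < γ) (hs : 0 < s)
    (hκ : ∀ i, 0 < κ i) (hκρ : ∀ i, κ i ≤ ρ)
    (hupper : ∀ i, ∀ x ∈ K, ∀ y ∈ K, |g i x - g i y| ≤ ρ * |x - y|)
    (hlower : ∀ i, ∀ x ∈ K, ∀ y ∈ K, κ i * |x - y| ≤ |g i x - g i y|)
    (hsep : ∀ i j, i ≠ j → ∀ x ∈ K, ∀ y ∈ K, γ ≤ |g i x - g j y|)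
    (hsum : 1 ≤ ∑ i, κ i ^ s) : ENNReal.ofReal s ≤ dimH K := by
  obtain ⟨x₀, hx₀⟩ := hne
  obtain ⟨P, hP⟩ := exists_cover_of_lengths (fun i => κ i ^ s) Finset.univ
  have hp : ∀ i, 0 < κ i ^ s := fun i => Real.rpow_pos_of_pos (hκ i) s
  -- Cells of length κ_i ^ s cover [0, 1). Below, T rescales the chosen cell of t to unit length, so
  -- iterating T codes t by a sequence of contractions; applying the first n of them to x₀ gives `x
  -- n t`.
  have hcode : ∀ t : Ico (0 : ℝ) 1, ∃ i, P i ≤ t ∧ (t : ℝ) < P i + κ i ^ s := by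
    intro t
    obtain ⟨i, -, hi⟩ := hP t t.2.1 (t.2.2.trans_le hsum)
    exact ⟨i, hi⟩
  choose j hj using hcode
  set T : Ico (0 : ℝ) 1 → Ico (0 : ℝ) 1 := fun t => ⟨(t - P (j t)) / κ (j t) ^ s,
    div_nonneg (by linarith [(hj t).1]) (hp _).le,
    (div_lt_one (hp _)).2 (by linarith [(hj t).2])⟩ with hT
  set x : ℕ → Ico (0 : ℝ) 1 → ℝ :=
    fun n => Nat.rec (fun _ => x₀) (fun _ w t => g (j t) (w (T t))) n with hx
  have x_succ : ∀ n t, x (n + 1) t = g (j t) (x n (T t)) := fun n t => rfl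
  have hxK : ∀ n t, x n t ∈ K := by
    intro n
    induction n with
    | zero => exact fun _ => hx₀
    | succ n ih => exact fun t => by rw [x_succ]; exact hgK _ (ih _)
  obtain ⟨i₀, -⟩ : ∃ i : ι, True := ⟨j ⟨0, by simp⟩, trivial⟩
  have hρ0 : 0 < ρ := (hκ i₀).trans_le (hκρ i₀)
  have hstep : ∀ n t, |x n t - x (n + 1) t| ≤ 1 * ρ ^ n := by
    intro n
    induction n with
    | zero => exact fun t => by simpa using hdiam _ (hxK 0 t) _ (hxK 1 t)
    | succ n ih =>
      intro t
      rw [x_succ, x_succ (n + 1)]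
      calc _ ≤ ρ * |x n (T t) - x (n + 1) (T t)| := hupper _ _ (hxK n _) _ (hxK (n + 1) _)
        _ ≤ ρ * (1 * ρ ^ n) := by gcongr; exact ih _
        _ = _ := by ring
  have hlim : ∀ t, ∃ z, Tendsto (fun n => x n t) atTop (𝓝 z) := fun t =>
    cauchySeq_tendsto_of_complete (cauchySeq_of_le_geometric ρ 1 hρ fun n => hstep n t)
  choose z hz using hlim
  set q := ρ ^ s with hq
  have hq0 : 0 < q := Real.rpow_pos_of_pos hρ0 s
  have hq1 : q < 1 := Real.rpow_lt_one hρ0.le hρ hs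
  have hpq : ∀ i, κ i ^ s ≤ q := fun i => Real.rpow_le_rpow (hκ i).le (hκρ i) hs.le
  -- If t and t' share a cell, both sides scale by κ^s. If not, the separation makes the first term
  -- on the right at least 1. The error qⁿ disappears in the limit.
  have key : ∀ n (t t' : Ico (0 : ℝ) 1),
      |(t : ℝ) - t'| ≤ γ ^ (-s) * |x n t - x n t'| ^ s + q ^ n := by
    intro n
    have hone : ∀ t t' : Ico (0 : ℝ) 1, |(t : ℝ) - t'| ≤ 1 := fun t t' => by
      rw [abs_le]; constructor <;> linarith [t.2.1, t.2.2, t'.2.1, t'.2.2]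
    induction n with
    | zero =>
      intro t t'
      rw [pow_zero]
      have : 0 ≤ γ ^ (-s) * |x 0 t - x 0 t'| ^ s := by positivity
      linarith [hone t t']
    | succ n ih =>
      intro t t'
      rw [x_succ, x_succ]
      by_cases h : j t = j t'
      · have e1 : (t : ℝ) - t' = κ (j t) ^ s * ((T t : ℝ) - T t') := by
          have := (hp (j t')).ne'
          simp only [hT, h]
          field_simp
          ring
        rw [e1, abs_mul, abs_of_pos (hp _), ← h]
        have e2 := hlower (j t) _ (hxK n (T t)) _ (hxK n (T t'))
        have e3 : κ (j t) ^ s * |x n (T t) - x n (T t')| ^ s ≤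
            |g (j t) (x n (T t)) - g (j t) (x n (T t'))| ^ s := by
          rw [← Real.mul_rpow (hκ _).le (abs_nonneg _)]
          exact Real.rpow_le_rpow (mul_nonneg (hκ _).le (abs_nonneg _)) e2 hs.le
        calc κ (j t) ^ s * |(T t : ℝ) - T t'|
            ≤ κ (j t) ^ s * (γ ^ (-s) * |x n (T t) - x n (T t')| ^ s + q ^ n) :=
              mul_le_mul_of_nonneg_left (ih _ _) (hp _).le
          _ = γ ^ (-s) * (κ (j t) ^ s * |x n (T t) - x n (T t')| ^ s) + κ (j t) ^ s * q ^ n := by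
              ring
          _ ≤ γ ^ (-s) * |g (j t) (x n (T t)) - g (j t) (x n (T t'))| ^ s + q * q ^ n := by
              gcongr
              exact hpq _
          _ = _ := by ring
      · have e1 := hsep _ _ h _ (hxK n (T t)) _ (hxK n (T t'))
        have e2 := Real.rpow_le_rpow hγ.le e1 hs.le
        have e3 : γ ^ (-s) * γ ^ s = 1 := by
          rw [← Real.rpow_add hγ]; simp
        have e4 : γ ^ (-s) * γ ^ s ≤
            γ ^ (-s) * |g (j t) (x n (T t)) - g (j t') (x n (T t'))| ^ s := by gcongr
        have : 0 < q ^ (n + 1) := by positivity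
        linarith [hone t t']
  refine le_dimH_of_inverse_holder (H := γ ^ (-s)) hs z
    (fun t => hK.mem_of_tendsto (hz t) (Eventually.of_forall fun n => hxK n t)) fun t t' => ?_
  have l1 : Tendsto (fun n => γ ^ (-s) * |x n t - x n t'| ^ s + q ^ n) atTop
      (𝓝 (γ ^ (-s) * |z t - z t'| ^ s + 0)) :=
    ((((hz t).sub (hz t')).abs.rpow_const (Or.inr hs.le)).const_mul _).add
      (tendsto_pow_atTop_nhds_zero_of_lt_one hq0.le hq1)
  rw [add_zero] at l1
  exact ge_of_tendsto' l1 fun n => key n t t'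

/-! ### The regular Cantor set of a system of full branches. -/

section

variable {f : ℝ → ℝ}

/-- The union of the intervals of a set of full branches. -/
def branchUnion (T : Set (FullBranch f)) : Set ℝ := ⋃ t ∈ T, t.interval

open Classical in
/-- The map given on the interval of each full branch by the corresponding iterate of `f`. -/
noncomputable def branchMap (T : Set (FullBranch f)) (x : ℝ) : ℝ :=
  if h : ∃ t ∈ T, x ∈ t.interval then f^[h.choose.time] x else 0

/-- The points whose orbit under `branchMap T` stays in the intervals of the branches. -/
def survivors (T : Set (FullBranch f)) : Set ℝ :=
  {x | ∀ n, (branchMap T)^[n] x ∈ branchUnion T}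

/-- A set of full branches with disjoint intervals in `(1/8, 1/4)`. -/
structure IsBranchSystem (T : Set (FullBranch f)) : Prop where
  finite : T.Finite
  pairwiseDisjoint : T.PairwiseDisjoint FullBranch.interval
  left_gt : ∀ t ∈ T, 1 / 8 < t.left
  right_lt : ∀ t ∈ T, t.right < 1 / 4
  nontrivial : T.Nontrivial

variable {T T' : Set (FullBranch f)}

lemma mem_branchUnion {x : ℝ} : x ∈ branchUnion T ↔ ∃ t ∈ T, x ∈ t.interval := by
  simp [branchUnion]

lemma branchUnion_mono (h : T ⊆ T') : branchUnion T ⊆ branchUnion T' :=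
  biUnion_subset_biUnion_left h

lemma eq_of_mem_interval (hT : T.PairwiseDisjoint FullBranch.interval) {t t' : FullBranch f}
    (ht : t ∈ T) (ht' : t' ∈ T) {x : ℝ} (h : x ∈ t.interval) (h' : x ∈ t'.interval) : t = t' := by
  by_contra hne
  exact Set.disjoint_left.1 (hT ht ht' hne) h h'

lemma branchMap_eq (hT : T.PairwiseDisjoint FullBranch.interval) {t : FullBranch f} (ht : t ∈ T)
    {x : ℝ} (hx : x ∈ t.interval) : branchMap T x = f^[t.time] x := by
  have h : ∃ t ∈ T, x ∈ t.interval := ⟨t, ht, hx⟩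
  rw [branchMap, dif_pos h,
    eq_of_mem_interval hT h.choose_spec.1 ht h.choose_spec.2 hx]

lemma mem_survivors {x : ℝ} :
    x ∈ survivors T ↔ x ∈ branchUnion T ∧ branchMap T x ∈ survivors T := by
  constructor
  · intro h
    exact ⟨h 0, fun n => h (n + 1)⟩
  · rintro ⟨h1, h2⟩ n
    cases n with
    | zero => exact h1
    | succ n => exact h2 n

/-- Disjointness forces the two branch maps to agree on the smaller union, so orbits of survivors
coincide. -/
lemma survivors_mono (hT' : T'.PairwiseDisjoint FullBranch.interval) (h : T ⊆ T') :
    survivors T ⊆ survivors T' := by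
  have hT : T.PairwiseDisjoint FullBranch.interval := hT'.subset h
  intro x hx n
  have : (branchMap T')^[n] x = (branchMap T)^[n] x := by
    induction n with
    | zero => rfl
    | succ n ih =>
      rw [Function.iterate_succ_apply', Function.iterate_succ_apply', ih]
      obtain ⟨t, ht, htx⟩ := mem_branchUnion.1 (hx n)
      rw [branchMap_eq hT' (h ht) htx, branchMap_eq hT ht htx]
  rw [this]
  exact branchUnion_mono h (hx n)

/-- Finitely many disjoint compact intervals lie at positive mutual distance. The gap serves total
disconnectedness, the Hölder bound across intervals and the separation in the dimension estimate. -/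
lemma exists_interval_gap (hT : IsBranchSystem T) :
    ∃ γ > 0, ∀ t ∈ T, ∀ t' ∈ T, t ≠ t' → ∀ x ∈ t.interval, ∀ y ∈ t'.interval, γ ≤ |x - y| := by
  have single : ∀ P : FullBranch f × FullBranch f, ∃ γ > 0, P.1 ∈ T → P.2 ∈ T → P.1 ≠ P.2 →
      ∀ x ∈ P.1.interval, ∀ y ∈ P.2.interval, γ ≤ |x - y| := by
    rintro ⟨t, t'⟩
    by_cases h : t ∈ T ∧ t' ∈ T ∧ t ≠ t'
    · have hd := hT.pairwiseDisjoint h.1 h.2.1 h.2.2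
      rcases lt_or_ge t.right t'.left with h1 | h1
      · refine ⟨t'.left - t.right, by linarith, fun _ _ _ x hx y hy => ?_⟩
        rw [abs_sub_comm]
        linarith [hx.2, hy.1, le_abs_self (y - x)]
      rcases lt_or_ge t'.right t.left with h2 | h2
      · refine ⟨t.left - t'.right, by linarith, fun _ _ _ x hx y hy => ?_⟩
        linarith [hx.1, hy.2, le_abs_self (x - y)]
      · exfalso
        exact Set.disjoint_left.1 hd
          (show max t.left t'.left ∈ t.interval from ⟨le_max_left _ _, max_le t.lt.le h1⟩)
          ⟨le_max_right _ _, max_le h2 t'.lt.le⟩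
    · exact ⟨1, one_pos, fun h1 h2 h3 => absurd ⟨h1, h2, h3⟩ h⟩
  choose γ hγ hγ' using single
  obtain ⟨t₀, ht₀⟩ := hT.nontrivial.nonempty
  obtain ⟨P, -, hP⟩ := Set.exists_min_image (T ×ˢ T) γ (hT.finite.prod hT.finite)
    ⟨(t₀, t₀), ht₀, ht₀⟩
  exact ⟨γ P, hγ P, fun t ht t' ht' hne x hx y hy =>
    (hP (t, t') ⟨ht, ht'⟩).trans (hγ' (t, t') ht ht' hne x hx y hy)⟩

end

namespace IsLorenzMap

variable {f : ℝ → ℝ} {lam B β : ℝ} {T : Set (FullBranch f)}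

lemma image_branch (hf : IsLorenzMap f lam B β) (t : FullBranch f) :
    f^[t.time] '' t.interval = Icc (1 / 8) (1 / 4) := by
  rw [FullBranch.interval, hf.image_iterate_Icc t.lt.le t.subset, t.map_left, t.map_right]

lemma branch_expands (hf : IsLorenzMap f lam B β) (t : FullBranch f) {x y : ℝ}
    (hx : x ∈ t.interval) (hy : y ∈ t.interval) (hxy : x ≤ y) :
    lam * (y - x) ≤ f^[t.time] y - f^[t.time] x := by
  have h1 := hf.pow_mul_sub_le hxy ((Icc_subset_Icc hx.1 hy.2).trans t.subset)
  have h2 : lam ^ 1 ≤ lam ^ t.time := pow_le_pow_right₀ hf.one_lt.le t.one_le_time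
  rw [pow_one] at h2
  have : 0 ≤ y - x := by linarith
  exact (mul_le_mul_of_nonneg_right h2 this).trans h1

lemma abs_branch_expands (hf : IsLorenzMap f lam B β) (t : FullBranch f) {x y : ℝ}
    (hx : x ∈ t.interval) (hy : y ∈ t.interval) :
    lam * |x - y| ≤ |f^[t.time] x - f^[t.time] y| := by
  wlog hxy : x ≤ y generalizing x y
  · rw [abs_sub_comm x, abs_sub_comm (f^[t.time] x)]
    exact this hy hx (le_of_not_ge hxy)
  rw [abs_sub_comm x, abs_sub_comm (f^[t.time] x), abs_of_nonneg (by linarith : 0 ≤ y - x)]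
  exact (hf.branch_expands t hx hy hxy).trans (le_abs_self _)

lemma survivors_subset_Ioo (hT : IsBranchSystem T) : survivors T ⊆ Ioo (1 / 8) (1 / 4) := by
  intro x hx
  obtain ⟨t, ht, htx⟩ := mem_branchUnion.1 (mem_survivors.1 hx).1
  exact ⟨(hT.left_gt t ht).trans_le htx.1, htx.2.trans_lt (hT.right_lt t ht)⟩

lemma abs_sub_le_one_of_survivors (hT : IsBranchSystem T) {x y : ℝ} (hx : x ∈ survivors T)
    (hy : y ∈ survivors T) : |x - y| ≤ 1 := by
  have h1 := survivors_subset_Ioo hT hx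
  have h2 := survivors_subset_Ioo hT hy
  rw [abs_le]
  constructor <;> linarith [h1.1, h1.2, h2.1, h2.2]

/-- The inverse of a full branch maps the set of survivors into itself. -/
lemma exists_survivor_preimage (hf : IsLorenzMap f lam B β) (hT : IsBranchSystem T)
    {t : FullBranch f} (ht : t ∈ T) {y : ℝ} (hy : y ∈ survivors T) :
    ∃ x ∈ t.interval, x ∈ survivors T ∧ branchMap T x = y ∧ f^[t.time] x = y := by
  have h1 : y ∈ f^[t.time] '' t.interval := by
    rw [hf.image_branch t]
    exact Ioo_subset_Icc_self (survivors_subset_Ioo hT hy)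
  obtain ⟨x, hx, hxy⟩ := h1
  have h2 : branchMap T x = y := (branchMap_eq hT.pairwiseDisjoint ht hx).trans hxy
  exact ⟨x, hx, mem_survivors.2 ⟨mem_branchUnion.2 ⟨t, ht, hx⟩, h2 ▸ hy⟩, h2, hxy⟩

/-- The branch map need not be continuous on the line, so closedness is proved level by level,
through preimages under the iterates on each closed branch interval. -/
lemma isClosed_survivors (hf : IsLorenzMap f lam B β) (hT : IsBranchSystem T) :
    IsClosed (survivors T) := by
  have hlevel : ∀ n, IsClosed {x | ∀ i < n, (branchMap T)^[i] x ∈ branchUnion T} := by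
    intro n
    induction n with
    | zero => simp
    | succ n ih =>
      have : {x | ∀ i < n + 1, (branchMap T)^[i] x ∈ branchUnion T} =
          ⋃ t ∈ T, t.interval ∩ f^[t.time] ⁻¹'
            {x | ∀ i < n, (branchMap T)^[i] x ∈ branchUnion T} := by
        ext x
        simp only [mem_iUnion, mem_inter_iff, mem_preimage, mem_ofPred_eq, exists_prop]
        constructor
        · intro h
          obtain ⟨t, ht, htx⟩ := mem_branchUnion.1 (h 0 (Nat.succ_pos n))
          change x ∈ t.interval at htx
          refine ⟨t, ht, htx, fun i hi => ?_⟩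
          rw [← branchMap_eq hT.pairwiseDisjoint ht htx]
          exact h (i + 1) (by omega)
        · rintro ⟨t, ht, htx, h⟩ i hi
          cases i with
          | zero => exact mem_branchUnion.2 ⟨t, ht, htx⟩
          | succ i =>
            rw [Function.iterate_succ_apply, branchMap_eq hT.pairwiseDisjoint ht htx]
            exact h i (by omega)
      rw [this]
      exact hT.finite.isClosed_biUnion fun t _ =>
        ((hf.continuousOn_iterate t.time).mono t.subset).preimage_isClosed_of_isClosed
          isClosed_Icc ih
  have : survivors T = ⋂ n, {x | ∀ i < n, (branchMap T)^[i] x ∈ branchUnion T} := by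
    ext x
    simp only [mem_iInter, mem_ofPred_eq, survivors]
    exact ⟨fun h n i _ => h i, fun h n => h (n + 1) n (Nat.lt_succ_self n)⟩
  rw [this]
  exact isClosed_iInter hlevel

lemma isCompact_survivors (hf : IsLorenzMap f lam B β) (hT : IsBranchSystem T) :
    IsCompact (survivors T) :=
  isCompact_Icc.of_isClosed_subset (hf.isClosed_survivors hT)
    ((survivors_subset_Ioo hT).trans Ioo_subset_Icc_self)

/-- A branch stretches its interval over a strictly larger one, so it has a fixed point by the
intermediate value theorem. -/
lemma survivors_nonempty (hf : IsLorenzMap f lam B β) (hT : IsBranchSystem T) :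
    (survivors T).Nonempty := by
  obtain ⟨t, ht⟩ := hT.nontrivial.nonempty
  have hcont : ContinuousOn (fun x => f^[t.time] x - x) (Icc t.left t.right) :=
    ((hf.continuousOn_iterate t.time).mono t.subset).sub continuousOn_id
  have h0 : (0 : ℝ) ∈ Icc (f^[t.time] t.left - t.left) (f^[t.time] t.right - t.right) := by
    rw [t.map_left, t.map_right]
    have := hT.left_gt t ht
    have := hT.right_lt t ht
    constructor <;> linarith
  obtain ⟨x, hx, hx0⟩ := intermediate_value_Icc t.lt.le hcont h0
  have hfix : branchMap T x = x := by
    rw [branchMap_eq hT.pairwiseDisjoint ht hx]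
    exact sub_eq_zero.1 hx0
  refine ⟨x, fun n => ?_⟩
  rw [Function.iterate_fixed hfix]
  exact mem_branchUnion.2 ⟨t, ht, hx⟩

lemma survivors_nontrivial (hf : IsLorenzMap f lam B β) (hT : IsBranchSystem T) :
    (survivors T).Nontrivial := by
  obtain ⟨y, hy⟩ := hf.survivors_nonempty hT
  obtain ⟨t, ht, t', ht', hne⟩ := hT.nontrivial
  obtain ⟨x, hx, hxK, -⟩ := hf.exists_survivor_preimage hT ht hy
  obtain ⟨x', hx', hxK', -⟩ := hf.exists_survivor_preimage hT ht' hy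
  refine ⟨x, hxK, x', hxK', fun h => hne ?_⟩
  subst h
  exact eq_of_mem_interval hT.pairwiseDisjoint ht ht' hx hx'

/-- A second survivor is pulled back n times along the branches followed by x; each pullback divides
the distance by at least λ. -/
lemma exists_survivor_near (hf : IsLorenzMap f lam B β) (hT : IsBranchSystem T) (n : ℕ) :
    ∀ x ∈ survivors T, ∃ y ∈ survivors T, y ≠ x ∧ lam ^ n * |x - y| ≤ 1 := by
  induction n with
  | zero =>
    intro x hx
    obtain ⟨y, hy, hne⟩ := (hf.survivors_nontrivial hT).exists_ne x
    exact ⟨y, hy, hne, by simpa using abs_sub_le_one_of_survivors hT hx hy⟩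
  | succ n ih =>
    intro x hx
    obtain ⟨hxA, hx'⟩ := mem_survivors.1 hx
    obtain ⟨t, ht, htx⟩ := mem_branchUnion.1 hxA
    obtain ⟨y, hy, hne, hd⟩ := ih _ hx'
    obtain ⟨z, hz, hzK, h1, h2⟩ := hf.exists_survivor_preimage hT ht hy
    refine ⟨z, hzK, fun h => hne (by rw [← h1, h]), ?_⟩
    have h3 := hf.abs_branch_expands t htx hz
    rw [h2, ← branchMap_eq hT.pairwiseDisjoint ht htx] at h3
    have hl : 0 < lam ^ n := pow_pos (by linarith [hf.one_lt]) n
    calc lam ^ (n + 1) * |x - z| = lam ^ n * (lam * |x - z|) := by ring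
      _ ≤ lam ^ n * |branchMap T x - y| := by gcongr
      _ ≤ 1 := hd

lemma perfect_survivors (hf : IsLorenzMap f lam B β) (hT : IsBranchSystem T) :
    Perfect (survivors T) := by
  refine ⟨hf.isClosed_survivors hT, fun x hx => ?_⟩
  rw [accPt_iff_nhds]
  intro U hU
  obtain ⟨ε, hε, hεU⟩ := Metric.mem_nhds_iff.1 hU
  obtain ⟨n, hn⟩ := pow_unbounded_of_one_lt (1 / ε) hf.one_lt
  obtain ⟨y, hy, hne, hd⟩ := hf.exists_survivor_near hT n x hx
  refine ⟨y, ⟨hεU ?_, hy⟩, hne⟩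
  rw [div_lt_iff₀ hε] at hn
  rw [Metric.mem_ball, Real.dist_eq, abs_sub_comm]
  have hl : 0 < lam ^ n := pow_pos (by linarith [hf.one_lt]) n
  exact lt_of_mul_lt_mul_left (hd.trans_lt hn) hl.le

/-- An interval of survivors cannot jump a gap, so it lies in one branch interval, and its expanded
image is again an interval of survivors, of length at most 1. -/
lemma pow_mul_sub_le_of_Icc_subset_survivors (hf : IsLorenzMap f lam B β) (hT : IsBranchSystem T)
    (n : ℕ) : ∀ x y, x ≤ y → Icc x y ⊆ survivors T → lam ^ n * (y - x) ≤ 1 := by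
  obtain ⟨γ, hγ, hgap⟩ := exists_interval_gap hT
  induction n with
  | zero =>
    intro x y hxy h
    have := abs_sub_le_one_of_survivors hT (h (right_mem_Icc.2 hxy)) (h (left_mem_Icc.2 hxy))
    rw [pow_zero, one_mul]
    exact (le_abs_self _).trans this
  | succ n ih =>
    intro x y hxy h
    obtain ⟨t, ht, htx⟩ := mem_branchUnion.1 (mem_survivors.1 (h (left_mem_Icc.2 hxy))).1
    have hty : y ≤ t.right := by
      by_contra! hlt
      set e := min (γ / 2) (y - t.right) with he
      have he0 : 0 < e := lt_min (by linarith) (by linarith)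
      have he1 : e ≤ γ / 2 := min_le_left _ _
      have he2 : e ≤ y - t.right := min_le_right _ _
      have hz : t.right + e ∈ survivors T := h ⟨by linarith [htx.2], by linarith⟩
      obtain ⟨t', ht', hz'⟩ := mem_branchUnion.1 (mem_survivors.1 hz).1
      have hne : t' ≠ t := by
        rintro rfl
        linarith [hz'.2]
      have := hgap t' ht' t ht hne _ hz' t.right (right_mem_Icc.2 t.lt.le)
      rw [add_sub_cancel_left, abs_of_pos he0] at this
      linarith
    have hyt : y ∈ t.interval := ⟨htx.1.trans hxy, hty⟩
    have hsub : Icc x y ⊆ t.interval := Icc_subset_Icc htx.1 hty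
    have himg := hf.image_iterate_Icc hxy (hsub.trans t.subset)
    have hexp := hf.branch_expands t htx hyt hxy
    have hl : 0 < lam := by linarith [hf.one_lt]
    have hle : f^[t.time] x ≤ f^[t.time] y := by
      have : 0 ≤ lam * (y - x) := mul_nonneg hl.le (by linarith)
      linarith
    have hK : Icc (f^[t.time] x) (f^[t.time] y) ⊆ survivors T := by
      rw [← himg]
      rintro _ ⟨z, hz, rfl⟩
      rw [← branchMap_eq hT.pairwiseDisjoint ht (hsub hz)]
      exact (mem_survivors.1 (h hz)).2
    calc lam ^ (n + 1) * (y - x) = lam ^ n * (lam * (y - x)) := by ring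
      _ ≤ lam ^ n * (f^[t.time] y - f^[t.time] x) := by gcongr
      _ ≤ 1 := ih _ _ hle hK

lemma isTotallyDisconnected_survivors (hf : IsLorenzMap f lam B β) (hT : IsBranchSystem T) :
    IsTotallyDisconnected (survivors T) := by
  intro s hs hpre x hx y hy
  wlog hxy : x ≤ y generalizing x y
  · exact (this hy hx (le_of_not_ge hxy)).symm
  by_contra hne
  have hlt : 0 < y - x := by
    have := lt_of_le_of_ne hxy hne
    linarith
  obtain ⟨n, hn⟩ := pow_unbounded_of_one_lt (1 / (y - x)) hf.one_lt
  have := hf.pow_mul_sub_le_of_Icc_subset_survivors hT n x y hxy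
    ((hpre.ordConnected.out hx hy).trans hs)
  rw [div_lt_iff₀ hlt] at hn
  linarith

lemma isCantorSet_survivors (hf : IsLorenzMap f lam B β) (hT : IsBranchSystem T) :
    IsCantorSet (survivors T) :=
  ⟨hf.survivors_nonempty hT, hf.isCompact_survivors hT, hf.perfect_survivors hT,
    hf.isTotallyDisconnected_survivors hT⟩

/-- The derivative of an iterate on the interval of a full branch is bounded and Lipschitz. -/
lemma exists_lipschitz_deriv_branch (hf : IsLorenzMap f lam B β) (t : FullBranch f) :
    ∃ L, (∀ x ∈ t.interval, |(orbitWeight f t.time x)⁻¹| ≤ L) ∧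
      ∀ x ∈ t.interval, ∀ y ∈ t.interval,
        |(orbitWeight f t.time x)⁻¹ - (orbitWeight f t.time y)⁻¹| ≤ L * |x - y| := by
  have hC : ContDiffOn ℝ 1 (fun x => (orbitWeight f t.time x)⁻¹) (orbitDomain f t.time) :=
    (hf.contDiffOn_orbitWeight t.time).inv fun x hx => (hf.orbitWeight_pos hx).ne'
  have hO := hf.isOpen_orbitDomain t.time
  obtain ⟨L₁, hL₁⟩ := isCompact_Icc.exists_bound_of_continuousOn
    (hC.continuousOn.mono t.subset)
  obtain ⟨L₂, hL₂⟩ := isCompact_Icc.exists_bound_of_continuousOn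
    ((hC.continuousOn_deriv_of_isOpen hO (by norm_num)).mono t.subset)
  refine ⟨max L₁ L₂, fun x hx => (hL₁ x hx).trans (le_max_left _ _), fun x hx y hy => ?_⟩
  have h : ‖(orbitWeight f t.time x)⁻¹ - (orbitWeight f t.time y)⁻¹‖ ≤ L₂ * ‖x - y‖ :=
    (convex_Icc t.left t.right).norm_image_sub_le_of_norm_hasDerivWithin_le
      (f := fun x => (orbitWeight f t.time x)⁻¹)
      (f' := fun z => deriv (fun x => (orbitWeight f t.time x)⁻¹) z)
      (fun z hz => ((hC.contDiffAt (hO.mem_nhds (t.subset hz))).differentiableAt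
        (by norm_num)).hasDerivAt.hasDerivWithinAt) hL₂ hy hx
  refine h.trans ?_
  rw [Real.norm_eq_abs]
  gcongr
  exact le_max_right _ _

lemma hasDerivAt_branchMap (hf : IsLorenzMap f lam B β) (hT : IsBranchSystem T)
    {t : FullBranch f} (ht : t ∈ T) {x : ℝ} (hx : x ∈ Ioo t.left t.right) :
    HasDerivAt (branchMap T) (orbitWeight f t.time x)⁻¹ x := by
  refine (hf.hasDerivAt_iterate (t.subset (Ioo_subset_Icc_self hx))).congr_of_eventuallyEq ?_
  filter_upwards [isOpen_Ioo.mem_nhds hx] with z hz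
  exact branchMap_eq hT.pairwiseDisjoint ht (Ioo_subset_Icc_self hz)

/-- The exponent is 1. Within a branch the derivative is Lipschitz; across branches its jump is at
most twice the uniform bound, which the gap γ turns into a multiple of |x - y|. -/
lemma isHolderExpandingNear_branchMap (hf : IsLorenzMap f lam B β) (hT : IsBranchSystem T)
    {A : Set ℝ} (hA : A ⊆ ⋃ t ∈ T, Ioo t.left t.right) :
    IsHolderExpandingNear (branchMap T) A := by
  refine ⟨⋃ t ∈ T, Ioo t.left t.right, isOpen_biUnion fun t _ => isOpen_Ioo, hA, ?_,
    ⟨1, one_pos, le_rfl, ?_⟩, lam, hf.one_lt, ?_⟩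
  · intro x hx
    obtain ⟨t, ht, htx⟩ := mem_iUnion₂.1 hx
    have h1 : ContDiffAt ℝ 1 f^[t.time] x :=
      (((hf.contDiffOn_iterate t.time).2.contDiffAt ((hf.isOpen_orbitDomain t.time).mem_nhds
        (t.subset (Ioo_subset_Icc_self htx)))).of_le (by norm_num))
    refine (h1.congr_of_eventuallyEq ?_).contDiffWithinAt
    filter_upwards [isOpen_Ioo.mem_nhds htx] with z hz
    exact branchMap_eq hT.pairwiseDisjoint ht (Ioo_subset_Icc_self hz)
  · obtain ⟨γ, hγ, hgap⟩ := exists_interval_gap hT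
    choose L hL1 hL2 using fun t : FullBranch f => hf.exists_lipschitz_deriv_branch t
    obtain ⟨L₀, hL₀⟩ := (hT.finite.toFinset.image L).exists_le
    have hL₀' : ∀ t ∈ T, L t ≤ max L₀ 0 := fun t ht =>
      (hL₀ _ (Finset.mem_image_of_mem L (hT.finite.mem_toFinset.2 ht))).trans (le_max_left _ _)
    have hM0 : 0 ≤ max L₀ 0 := le_max_right _ _
    refine ⟨(max L₀ 0 + 2 * max L₀ 0 / γ).toNNReal, ?_⟩
    rw [holderOnWith_one]
    refine LipschitzOnWith.of_dist_le_mul fun x hx y hy => ?_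
    obtain ⟨t, ht, htx⟩ := mem_iUnion₂.1 hx
    obtain ⟨t', ht', hty⟩ := mem_iUnion₂.1 hy
    rw [(hf.hasDerivAt_branchMap hT ht htx).deriv, (hf.hasDerivAt_branchMap hT ht' hty).deriv,
      Real.dist_eq, Real.dist_eq, Real.coe_toNNReal _ (by positivity), add_mul]
    have hx' := Ioo_subset_Icc_self htx
    have hy' := Ioo_subset_Icc_self hty
    by_cases h : t = t'
    · subst h
      have h1 := hL2 t x hx' y hy'
      have h2 : L t * |x - y| ≤ max L₀ 0 * |x - y| := by
        have := hL₀' t ht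
        gcongr
      have h3 : 0 ≤ 2 * max L₀ 0 / γ * |x - y| := by positivity
      linarith
    · have h1 := hgap t ht t' ht' h x hx' y hy'
      have h2 := (hL1 t x hx').trans (hL₀' t ht)
      have h3 := (hL1 t' y hy').trans (hL₀' t' ht')
      have h4 := abs_sub (orbitWeight f t.time x)⁻¹ (orbitWeight f t'.time y)⁻¹
      have h5 : 2 * max L₀ 0 ≤ 2 * max L₀ 0 / γ * |x - y| := by
        rw [div_mul_eq_mul_div, le_div_iff₀ hγ]
        gcongr
      have h6 : 0 ≤ max L₀ 0 * |x - y| := by positivity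
      linarith
  · intro x hx
    obtain ⟨t, ht, htx⟩ := mem_iUnion₂.1 hx
    rw [(hf.hasDerivAt_branchMap hT ht htx).deriv]
    have hx' := t.subset (Ioo_subset_Icc_self htx)
    have h1 := hf.orbitWeight_le hx'
    have h2 := hf.orbitWeight_pos hx'
    have hl := hf.one_lt
    refine le_trans ?_ (le_abs_self _)
    rw [inv_pow] at h1
    refine le_trans ?_ ((le_inv_comm₀ h2 (by positivity)).1 h1)
    calc lam = lam ^ 1 := (pow_one _).symm
      _ ≤ _ := pow_le_pow_right₀ hl.le t.one_le_time

/-- The set of survivors of a system of full branches is a regular Cantor set for `f`. -/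
lemma isRegularCantorSetFor_survivors (hf : IsLorenzMap f lam B β) (hT : IsBranchSystem T) :
    IsRegularCantorSetFor f (survivors T) := by
  set K := survivors T with hK
  have hKc := hf.isCompact_survivors hT
  have hKn := hf.survivors_nonempty hT
  -- Endpoints of Markov intervals must lie in K. The branch intervals are therefore shrunk to the
  -- preimages of [p, q], the convex hull of K; each is then mapped onto the hull of all of them.
  obtain ⟨p, hp, hpK⟩ := hKc.exists_isLeast hKn
  obtain ⟨q, hq, hqK⟩ := hKc.exists_isGreatest hKn
  have hpq : p < q := by
    obtain ⟨x, hx, y, hy, hne⟩ := hf.survivors_nontrivial hT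
    rcases lt_or_gt_of_ne hne with h | h
    · exact (hpK hx).trans_lt (h.trans_le (hqK hy))
    · exact (hpK hy).trans_lt (h.trans_le (hqK hx))
  have hdisj := hT.pairwiseDisjoint
  have hpIoo := survivors_subset_Ioo hT hp
  have hqIoo := survivors_subset_Ioo hT hq
  -- the intervals of the Markov partition
  have hends : ∀ t ∈ T, ∃ a b, a ∈ K ∧ b ∈ K ∧ t.left < a ∧ a < b ∧ b < t.right ∧
      f^[t.time] a = p ∧ f^[t.time] b = q := by
    intro t ht
    obtain ⟨a, ha, haK, -, ha'⟩ := hf.exists_survivor_preimage hT ht hp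
    obtain ⟨b, hb, hbK, -, hb'⟩ := hf.exists_survivor_preimage hT ht hq
    have hmono := hf.strictMonoOn_iterate t.subset
    refine ⟨a, b, haK, hbK, ?_, ?_, ?_, ha', hb'⟩
    · rw [← hmono.lt_iff_lt (left_mem_Icc.2 t.lt.le) ha, t.map_left, ha']
      exact hpIoo.1
    · rw [← hmono.lt_iff_lt ha hb, ha', hb']
      exact hpq
    · rw [← hmono.lt_iff_lt hb (right_mem_Icc.2 t.lt.le), t.map_right, hb']
      exact hqIoo.2
  have : Fintype T := hT.finite.fintype
  set e := (Fintype.equivFin T).symm with he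
  choose a b haK hbK hla hab hbr hfa hfb using fun j => hends (e j).1 (e j).2
  have hsub : ∀ j, Icc (a j) (b j) ⊆ (e j).1.interval := fun j =>
    Icc_subset_Icc (hla j).le (hbr j).le
  have hψ : ∀ j, ∀ x ∈ Icc (a j) (b j), branchMap T x = f^[(e j).1.time] x := fun j x hx =>
    branchMap_eq hdisj (e j).2 (hsub j hx)
  have himg : ∀ j, branchMap T '' Icc (a j) (b j) = Icc p q := by
    intro j
    rw [image_congr (hψ j), hf.image_iterate_Icc (hab j).le ((hsub j).trans (e j).1.subset),
      hfa, hfb]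
  have hmem : ∀ j, ∀ x ∈ K, x ∈ (e j).1.interval → x ∈ Icc (a j) (b j) := by
    intro j x hx hxj
    have h1 : f^[(e j).1.time] x ∈ K := by
      rw [← branchMap_eq hdisj (e j).2 hxj]
      exact (mem_survivors.1 hx).2
    have hmono := hf.strictMonoOn_iterate (e j).1.subset
    constructor
    · rw [← hmono.le_iff_le ((hsub j) (left_mem_Icc.2 (hab j).le)) hxj, hfa]
      exact hpK h1
    · rw [← hmono.le_iff_le hxj ((hsub j) (right_mem_Icc.2 (hab j).le)), hfb]
      exact hqK h1
  have hcover : K ⊆ ⋃ j, Icc (a j) (b j) := by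
    intro x hx
    obtain ⟨t, ht, htx⟩ := mem_branchUnion.1 (mem_survivors.1 hx).1
    refine mem_iUnion.2 ⟨e.symm ⟨t, ht⟩, hmem _ x hx ?_⟩
    rwa [Equiv.apply_symm_apply]
  have honto : ∀ j, branchMap T '' (K ∩ Icc (a j) (b j)) = K := by
    intro j
    apply Subset.antisymm
    · rintro _ ⟨x, hx, rfl⟩
      exact (mem_survivors.1 hx.1).2
    · intro y hy
      obtain ⟨x, hx, hxK, hxy, -⟩ := hf.exists_survivor_preimage hT (e j).2 hy
      exact ⟨x, ⟨hxK, hmem j x hxK hx⟩, hxy⟩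
  have j₀ : Fin (Fintype.card T) := e.symm ⟨_, hT.nontrivial.nonempty.some_mem⟩
  have hontoK : branchMap T '' K = K := by
    apply Subset.antisymm
    · rintro _ ⟨x, hx, rfl⟩
      exact (mem_survivors.1 hx).2
    · conv_lhs => rw [← honto j₀]
      exact image_mono inter_subset_left
  have hontoK' : ∀ n, (branchMap T)^[n] '' K = K := by
    intro n
    induction n with
    | zero => simp
    | succ n ih => rw [Function.iterate_succ, image_comp, hontoK, ih]
  refine ⟨Fintype.card T, a, b, branchMap T, ⟨hf.isCantorSet_survivors hT, hab, ?_, hcover, haK,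
    hbK, ?_, fun j => ⟨Finset.univ, ⟨j, Finset.mem_univ j⟩, ?_⟩, fun j => ?_, ?_⟩, fun j => ?_⟩
  · intro i j hij
    refine (hdisj (e i).2 (e j).2 fun h => hij (e.injective (Subtype.ext h))).mono
      (hsub i) (hsub j)
  · refine hf.isHolderExpandingNear_branchMap hT (iUnion_subset fun j x hx => ?_)
    exact mem_iUnion₂.2 ⟨(e j).1, (e j).2, (hla j).trans_le hx.1, hx.2.trans_lt (hbr j)⟩
  · rw [himg j]
    simp only [Finset.mem_univ, iUnion_true]
    apply Subset.antisymm
    · have h1 := subset_convexHull ℝ _ (hcover hp)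
      have h2 := subset_convexHull ℝ _ (hcover hq)
      have := (convex_convexHull ℝ (⋃ j, Icc (a j) (b j))).ordConnected.out h1 h2
      exact this
    · refine convexHull_min (iUnion_subset fun i => ?_) (convex_Icc p q)
      exact Icc_subset_Icc (hpK (haK i)) (hqK (hbK i))
  -- One step already maps each part of K onto K.
  · filter_upwards [eventually_ge_atTop 1] with n hn
    obtain ⟨n, rfl⟩ := Nat.exists_eq_add_of_le' hn
    rw [Function.iterate_succ, image_comp, honto j, hontoK']
  · apply Subset.antisymm
    · intro x hx
      refine mem_iInter.2 fun n => hcover ?_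
      rw [← hontoK' n]
      exact mem_image_of_mem _ hx
    · intro x hx n
      obtain ⟨j, hj⟩ := mem_iUnion.1 (mem_iInter.1 hx n)
      exact mem_branchUnion.2 ⟨(e j).1, (e j).2, hsub j hj⟩
  · exact ⟨(e j).1.time, (e j).1.one_le_time, fun x hx =>
      ⟨fun i hi => puncturedInterior_subset ((e j).1.subset (hsub j hx) i hi), hψ j x hx⟩⟩

/-- Lower bound of the Hausdorff dimension of the set of survivors. -/
lemma le_dimH_survivors (hf : IsLorenzMap f lam B β) (hT : IsBranchSystem T) {ι : Type*}
    [Fintype ι] {b : ι → FullBranch f} {κ : ι → ℝ} {s : ℝ} (hs : 0 < s) (hb : ∀ i, b i ∈ T)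
    (hinj : Function.Injective b)
    (hκ : ∀ i, 0 < κ i ∧ ∀ x ∈ (b i).interval, ∀ y ∈ (b i).interval,
        κ i * |f^[(b i).time] x - f^[(b i).time] y| ≤ |x - y|)
    (hsum : 1 ≤ ∑ i, κ i ^ s) : ENNReal.ofReal s ≤ dimH (survivors T) := by
  obtain ⟨γ, hγ, hgap⟩ := exists_interval_gap hT
  have hl := hf.one_lt
  have hl0 : 0 < lam := by linarith
  -- Inverse branches as total functions; off the survivors the value is arbitrary.
  have hpre : ∀ i y, ∃ x, y ∈ survivors T →
      x ∈ (b i).interval ∧ x ∈ survivors T ∧ f^[(b i).time] x = y := by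
    intro i y
    by_cases hy : y ∈ survivors T
    · obtain ⟨x, h1, h2, -, h3⟩ := hf.exists_survivor_preimage hT (hb i) hy
      exact ⟨x, fun _ => ⟨h1, h2, h3⟩⟩
    · exact ⟨0, fun h => absurd h hy⟩
  choose g hg using hpre
  refine le_dimH_of_contractions (hf.isClosed_survivors hT)
    (fun x hx y hy => abs_sub_le_one_of_survivors hT hx hy) (hf.survivors_nonempty hT) g
    (fun i x hx => (hg i x hx).2.1) (ρ := lam⁻¹) (inv_lt_one_of_one_lt₀ hl) hγ hs
    (fun i => (hκ i).1) (fun i => ?_) (fun i x hx y hy => ?_) (fun i x hx y hy => ?_)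
    (fun i j hij x hx y hy => ?_) hsum
  -- Comparing both expansion bounds at the endpoints gives κ_i λ ≤ 1.
  · have hL := left_mem_Icc.2 (b i).lt.le
    have hR := right_mem_Icc.2 (b i).lt.le
    have h1 := (hκ i).2 _ hR _ hL
    have h2 := hf.branch_expands (b i) hL hR (b i).lt.le
    have h3 : 0 < (b i).right - (b i).left := by linarith [(b i).lt]
    rw [abs_of_pos h3, abs_of_nonneg (by nlinarith)] at h1
    have h4 := (mul_le_mul_of_nonneg_left h2 (hκ i).1.le).trans h1
    rw [← mul_assoc] at h4
    have h5 : κ i * lam ≤ 1 := by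
      by_contra! h
      nlinarith
    rwa [← one_div, le_div_iff₀ hl0]
  · obtain ⟨x1, -, x3⟩ := hg i x hx
    obtain ⟨y1, -, y3⟩ := hg i y hy
    have := hf.abs_branch_expands (b i) x1 y1
    rw [x3, y3] at this
    rwa [inv_mul_eq_div, le_div_iff₀ hl0, mul_comm]
  · obtain ⟨x1, -, x3⟩ := hg i x hx
    obtain ⟨y1, -, y3⟩ := hg i y hy
    have := (hκ i).2 _ x1 _ y1
    rwa [x3, y3] at this
  · exact hgap _ (hb i) _ (hb j) (fun h => hij (hinj h)) _ (hg i x hx).1 _ (hg j y hy).1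

end IsLorenzMap

/-! ### Verification of the Lorenz properties and the increasing family. -/

/-- The identity (1/f')' = -f''/f'² and the two power bounds give |(1/f')'| ≤ C₁C²|x|^(-α). This is
integrable at 0 because α < 1: otherwise f' would be bounded, against its blow-up. -/
lemma exists_isLorenzMap {f : ℝ → ℝ} {α C C₁ : ℝ}
    (hmaps : MapsTo f puncturedInterval (Icc (-1 / 2 : ℝ) (1 / 2)))
    (hC2 : ContDiffOn ℝ 2 f puncturedInterval)
    (hf1_left : Tendsto f (𝓝[<] 0) (𝓝 (1 / 2)))
    (hf1_right : Tendsto f (𝓝[>] 0) (𝓝 (-1 / 2)))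
    (hf2 : ∀ x ∈ puncturedInterval, √2 < derivWithin f puncturedInterval x)
    (hf3_left : Tendsto (derivWithin f puncturedInterval) (𝓝[<] 0) atTop)
    (hf3_right : Tendsto (derivWithin f puncturedInterval) (𝓝[>] 0) atTop)
    (hC : 1 < C) (hC₁ : 1 < C₁)
    (hderiv : ∀ x ∈ puncturedInterval,
      1 / C ≤ derivWithin f puncturedInterval x / |x| ^ (α - 1) ∧
        derivWithin f puncturedInterval x / |x| ^ (α - 1) ≤ C)
    (hderiv2 : ∀ x ∈ puncturedInterval,
      |iteratedDerivWithin 2 f puncturedInterval x| / |x| ^ (α - 2) ≤ C₁) :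
    ∃ lam B β, IsLorenzMap f lam B β := by
  have hnhds : ∀ x ∈ puncturedInterior, puncturedInterval ∈ 𝓝 x := fun x hx =>
    mem_of_superset (isOpen_puncturedInterior.mem_nhds hx) puncturedInterior_subset
  have hdw : ∀ (h : ℝ → ℝ), ∀ x ∈ puncturedInterior,
      derivWithin h puncturedInterval x = deriv h x := fun h x hx =>
    derivWithin_of_mem_nhds (hnhds x hx)
  have huniq : UniqueDiffOn ℝ puncturedInterval := by
    rw [puncturedInterval, sdiff_eq]
    exact (uniqueDiffOn_Icc (by norm_num)).inter isOpen_compl_singleton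
  have hDcont : ContinuousOn (derivWithin f puncturedInterval) puncturedInterval :=
    hC2.continuousOn_derivWithin huniq (by norm_num)
  have hpos : ∀ x ∈ puncturedInterior, 0 < deriv f x := fun x hx => by
    rw [← hdw f x hx]
    exact (Real.sqrt_nonneg 2).trans_lt (hf2 x (puncturedInterior_subset hx))
  have hblow : ∀ M : ℝ, ∃ δ > 0, ∀ x ∈ puncturedInterval, |x| < δ →
      M ≤ derivWithin f puncturedInterval x := by
    intro M
    have h1 : ∀ᶠ x in 𝓝[≠] (0 : ℝ), M ≤ derivWithin f puncturedInterval x := by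
      rw [← Iio_union_Ioi, nhdsWithin_union, eventually_sup]
      exact ⟨hf3_left.eventually_ge_atTop M, hf3_right.eventually_ge_atTop M⟩
    rw [eventually_nhdsWithin_iff, Metric.eventually_nhds_iff] at h1
    obtain ⟨δ, hδ, h2⟩ := h1
    exact ⟨δ, hδ, fun x hx hxδ => h2 (by simpa using hxδ) hx.2⟩
  have hupper : ∀ x ∈ puncturedInterval,
      derivWithin f puncturedInterval x ≤ C * |x| ^ (α - 1) := fun x hx => by
    have h0 : 0 < |x| ^ (α - 1) := Real.rpow_pos_of_pos (abs_pos.2 hx.2) _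
    exact (div_le_iff₀ h0).1 (hderiv x hx).2
  have habs : ∀ x ∈ puncturedInterval, |x| ≤ 1 := fun x hx => by
    rw [abs_le]; constructor <;> linarith [hx.1.1, hx.1.2]
  have hα : α < 1 := by
    by_contra! h
    obtain ⟨δ, hδ, h1⟩ := hblow (C + 1)
    have hx : min (δ / 2) (1 / 2) ∈ puncturedInterval := by
      refine ⟨⟨?_, min_le_right _ _⟩, ?_⟩
      · exact (by norm_num : (-1 / 2 : ℝ) ≤ 0).trans (by positivity)
      · exact (by positivity : (0 : ℝ) < min (δ / 2) (1 / 2)).ne'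
    have h2 := h1 _ hx (by
      rw [abs_of_pos (by positivity)]
      exact (min_le_left _ _).trans_lt (by linarith))
    have h3 := hupper _ hx
    have h4 := Real.rpow_le_one (abs_nonneg _) (habs _ hx) (by linarith : 0 ≤ α - 1)
    have : C * |min (δ / 2) (1 / 2)| ^ (α - 1) ≤ C * 1 := by gcongr
    linarith
  -- Strict pointwise expansion becomes uniform: f' ≥ 2 near 0, and f' attains its minimum on the
  -- compact remainder.
  obtain ⟨lam, hlam, hlamD⟩ : ∃ lam, √2 < lam ∧ ∀ x ∈ puncturedInterval,
      lam ≤ derivWithin f puncturedInterval x := by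
    obtain ⟨δ, hδ, h1⟩ := hblow 2
    set δ' := min δ (1 / 2) with hδ'
    have hδ'0 : 0 < δ' := by positivity
    have hsub : Icc (-1 / 2 : ℝ) (1 / 2) ∩ {x | δ' ≤ |x|} ⊆ puncturedInterval := by
      rintro x ⟨hx, hx' : δ' ≤ |x|⟩
      refine ⟨hx, fun h => ?_⟩
      rw [mem_singleton_iff.1 h, abs_zero] at hx'
      linarith
    have hcomp : IsCompact (Icc (-1 / 2 : ℝ) (1 / 2) ∩ {x | δ' ≤ |x|}) :=
      isCompact_Icc.inter_right (isClosed_le continuous_const continuous_abs)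
    obtain ⟨x₀, hx₀, hmin⟩ := hcomp.exists_isMinOn
      ⟨1 / 2, ⟨by norm_num, by norm_num⟩, by
        rw [mem_ofPred_eq, abs_of_pos (by norm_num)]; exact min_le_right _ _⟩
      (hDcont.mono hsub)
    refine ⟨min 2 (derivWithin f puncturedInterval x₀), lt_min ?_ (hf2 _ (hsub hx₀)), ?_⟩
    · rw [Real.sqrt_lt' (by norm_num)]; norm_num
    · intro x hx
      by_cases h : |x| < δ'
      · exact (min_le_left _ _).trans (h1 x hx (h.trans_le (min_le_left _ _)))
      · exact (min_le_right _ _).trans (hmin ⟨hx.1, not_lt.1 h⟩)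
  have hmono : ∀ a b, Icc a b ⊆ puncturedInterval → StrictMonoOn f (Icc a b) := by
    intro a b hab
    refine strictMonoOn_of_deriv_pos (convex_Icc a b) (hC2.continuousOn.mono hab) fun x hx => ?_
    have hx' : x ∈ interior (Icc (-1 / 2 : ℝ) (1 / 2)) :=
      interior_mono (fun y hy => (hab hy).1) hx
    rw [interior_Icc] at hx'
    exact hpos x ⟨hx', (hab (interior_subset hx)).2⟩
  have h2sq : (2 : ℝ) < lam ^ 2 := by
    have := Real.sq_sqrt (by norm_num : (0 : ℝ) ≤ 2)
    have := Real.sqrt_nonneg 2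
    nlinarith
  -- Raising the exponent to at least 1/2 makes it positive whatever the sign of α, and only weakens
  -- the bound since |x| ≤ 1.
  refine ⟨lam, C₁ * C ^ 2, max α (1 / 2), ?_, h2sq, ?_, hC2.mono puncturedInterior_subset, ?_,
    hf1_left, hf1_right, by positivity, max_lt hα (by norm_num), by positivity, ?_, ?_, ?_⟩
  · have := Real.sqrt_nonneg 2
    nlinarith
  · intro x hx
    rcases lt_or_gt_of_ne (show x ≠ 0 from hx.2) with h | h
    · have hs : Icc (-1 / 2) (x / 2) ⊆ puncturedInterval := fun y hy =>
        ⟨⟨hy.1, by linarith [hy.2]⟩, by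
          have : y < 0 := by linarith [hy.2]
          exact this.ne⟩
      have hm := hmono _ _ hs
      have hx1 := hx.1.1
      have hxm : x ∈ Icc (-1 / 2) (x / 2) := ⟨hx1.le, by linarith⟩
      have hl : (-1 / 2 : ℝ) ∈ Icc (-1 / 2) (x / 2) := ⟨le_rfl, by linarith⟩
      have hr : x / 2 ∈ Icc (-1 / 2) (x / 2) := ⟨by linarith, le_rfl⟩
      exact ⟨(hmaps (hs hl)).1.trans_lt (hm hl hxm hx1),
        (hm hxm hr (by linarith)).trans_le (hmaps (hs hr)).2⟩
    · have hs : Icc (x / 2) (1 / 2) ⊆ puncturedInterval := fun y hy =>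
        ⟨⟨by linarith [hy.1], hy.2⟩, by
          have : 0 < y := by linarith [hy.1]
          exact this.ne'⟩
      have hm := hmono _ _ hs
      have hx1 := hx.1.2
      have hxm : x ∈ Icc (x / 2) (1 / 2) := ⟨by linarith, hx1.le⟩
      have hl : x / 2 ∈ Icc (x / 2) (1 / 2) := ⟨le_rfl, by linarith⟩
      have hr : (1 / 2 : ℝ) ∈ Icc (x / 2) (1 / 2) := ⟨by linarith, le_rfl⟩
      exact ⟨(hmaps (hs hl)).1.trans_lt (hm hl hxm (by linarith)),
        (hm hxm hr hx1).trans_le (hmaps (hs hr)).2⟩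
  · intro x hx
    rw [← hdw f x hx]
    exact hlamD x (puncturedInterior_subset hx)
  · intro x hx
    have hxP := puncturedInterior_subset hx
    have hx0 : 0 < |x| := abs_pos.2 hx.2
    have hD2 : iteratedDerivWithin 2 f puncturedInterval x = deriv (deriv f) x := by
      rw [iteratedDerivWithin_succ, hdw _ x hx]
      apply EventuallyEq.deriv_eq
      filter_upwards [isOpen_puncturedInterior.mem_nhds hx] with y hy
      rw [iteratedDerivWithin_one, hdw f y hy]
    have hdd : DifferentiableAt ℝ (deriv f) x :=
      (((hC2.mono puncturedInterior_subset).deriv_of_isOpen (m := 1) isOpen_puncturedInterior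
        (by norm_num)).contDiffAt (isOpen_puncturedInterior.mem_nhds hx)).differentiableAt
        (by norm_num)
    have hp := hpos x hx
    rw [(hdd.hasDerivAt.fun_inv hp.ne').deriv, abs_div, abs_neg, abs_of_pos (by positivity :
      0 < deriv f x ^ 2), ← hD2]
    have e1 : |iteratedDerivWithin 2 f puncturedInterval x| ≤ C₁ * |x| ^ (α - 2) :=
      (div_le_iff₀ (Real.rpow_pos_of_pos hx0 _)).1 (hderiv2 x hxP)
    have e2 : |x| ^ (α - 1) / C ≤ deriv f x := by
      have := (le_div_iff₀ (Real.rpow_pos_of_pos hx0 _)).1 (hderiv x hxP).1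
      rw [hdw f x hx] at this
      rw [div_eq_mul_one_div, mul_comm]
      exact this
    have e3 : 0 < |x| ^ (α - 1) := Real.rpow_pos_of_pos hx0 _
    have e4 : |x| ^ (α - 2) = |x| ^ (-α) * (|x| ^ (α - 1)) ^ 2 := by
      rw [← Real.rpow_natCast, ← Real.rpow_mul hx0.le, ← Real.rpow_add hx0]
      congr 1; push_cast; ring
    have e5 : |x| ^ (-α) ≤ |x| ^ (-max α (1 / 2)) :=
      Real.rpow_le_rpow_of_exponent_ge hx0 (habs x hxP) (neg_le_neg (le_max_left _ _))
    rw [div_le_iff₀ (by positivity)]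
    have e6 : (|x| ^ (α - 1) / C) ^ 2 ≤ deriv f x ^ 2 := by gcongr
    calc _ ≤ C₁ * |x| ^ (α - 2) := e1
      _ = C₁ * C ^ 2 * |x| ^ (-α) * (|x| ^ (α - 1) / C) ^ 2 := by
        rw [e4]; field_simp
      _ ≤ _ := by gcongr
  · intro τ hτ
    obtain ⟨δ, hδ, h1⟩ := hblow (1 / τ)
    refine ⟨δ / 2, by positivity, fun x hx hxδ => ?_⟩
    have := h1 x (puncturedInterior_subset hx) (by linarith)
    rw [hdw f x hx, one_div] at this
    exact inv_le_of_inv_le₀ hτ this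
  · intro δ hδ
    refine ⟨C * δ ^ (α - 1), fun x hx hxδ => ?_⟩
    rw [← hdw f x hx]
    refine (hupper x (puncturedInterior_subset hx)).trans ?_
    have := Real.rpow_le_rpow_of_nonpos hδ hxδ (by linarith : α - 1 ≤ 0)
    gcongr

/-- An increasing sequence of systems of full branches with prescribed lower bounds of the
dimension of the sets of survivors. -/
lemma IsLorenzMap.exists_branchSystems {f : ℝ → ℝ} {lam B β : ℝ} (hf : IsLorenzMap f lam B β)
    {s : ℕ → ℝ} (hs : ∀ k, 0 < s k) (hs1 : ∀ k, s k < 1) :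
    ∃ T : ℕ → Set (FullBranch f), Monotone T ∧ (∀ k, IsBranchSystem (T k)) ∧
      ∀ k, ENNReal.ofReal (s k) ≤ dimH (survivors (T k)) := by
  -- Reciprocals of consecutive integers give disjoint windows [u k, v k] inside (1/8, 1/4),
  -- decreasing towards 1/8.
  set u : ℕ → ℝ := fun k => 1 / 8 + 1 / (8 * (2 * k + 3)) with hu
  set v : ℕ → ℝ := fun k => 1 / 8 + 1 / (8 * (2 * k + 2)) with hv
  have hu8 : ∀ k, 1 / 8 < u k := fun k => by
    have : (0 : ℝ) < 1 / (8 * (2 * k + 3)) := by positivity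
    simp only [hu]; linarith
  have hv4 : ∀ k, v k < 1 / 4 := fun k => by
    have : (1 : ℝ) / (8 * (2 * k + 2)) ≤ 1 / (8 * 2) := by
      gcongr
      have : (0 : ℝ) ≤ k := by positivity
      linarith
    simp only [hv]; linarith
  have huv : ∀ k, u k < v k := fun k => by
    have : (1 : ℝ) / (8 * (2 * k + 3)) < 1 / (8 * (2 * k + 2)) := by
      gcongr; norm_num
    simp only [hu, hv]; linarith
  have hvu : ∀ i j, i < j → v j < u i := fun i j hij => by
    have h : (i : ℝ) + 1 ≤ j := by exact_mod_cast hij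
    have : (1 : ℝ) / (8 * (2 * j + 2)) < 1 / (8 * (2 * i + 3)) := by
      gcongr 1 / (8 * ?_); linarith
    simp only [hu, hv]; linarith
  choose ι hι b κ hb hdisj hκ hsum using fun k => hf.exists_branches (u := u k) (v := v k)
    (by linarith [hu8 k]) (huv k) (by linarith [hv4 k]) (hs1 k)
  have hne : ∀ k, Nonempty (ι k) := by
    intro k
    by_contra h
    rw [not_nonempty_iff] at h
    have := hsum k
    rw [Finset.univ_eq_empty, Finset.sum_empty] at this
    linarith
  have hinj : ∀ k, Function.Injective (b k) := by
    intro k i j hij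
    by_contra h
    have := hdisj k h
    simp only at this
    rw [hij, disjoint_self] at this
    exact (nonempty_Icc.2 (b k j).lt.le).ne_empty this
  have hfar : ∀ k l, k ≠ l → ∀ i j, Disjoint (b k i).interval (b l j).interval := by
    intro k l hkl i j
    refine Set.disjoint_left.2 fun x hx hx' => ?_
    have h1 := (hb k i).1.trans hx.1
    have h2 := hx.2.trans (hb k i).2
    have h3 := (hb l j).1.trans hx'.1
    have h4 := hx'.2.trans (hb l j).2
    rcases lt_or_gt_of_ne hkl with h | h
    · linarith [hvu _ _ h]
    · linarith [hvu _ _ h]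
  -- Stopping at k + 1 ensures at least two nonempty windows, hence two distinct branches, even for
  -- k = 0.
  set T : ℕ → Set (FullBranch f) := fun k => ⋃ i ∈ Iic (k + 1), range (b i) with hT
  have hmemT : ∀ k l, l ≤ k + 1 → ∀ i, b l i ∈ T k := fun k l hl i =>
    mem_iUnion₂.2 ⟨l, hl, mem_range_self i⟩
  have hTsys : ∀ k, IsBranchSystem (T k) := by
    intro k
    refine ⟨(finite_Iic _).biUnion fun i _ => finite_range _, ?_, ?_, ?_, ?_⟩
    · intro t ht t' ht' htt
      obtain ⟨l, -, i, rfl⟩ := mem_iUnion₂.1 ht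
      obtain ⟨l', -, j, rfl⟩ := mem_iUnion₂.1 ht'
      by_cases h : l = l'
      · subst h
        exact hdisj l fun h => htt (by rw [h])
      · exact hfar l l' h i j
    · intro t ht
      obtain ⟨l, -, i, rfl⟩ := mem_iUnion₂.1 ht
      exact (hu8 l).trans_le (hb l i).1
    · intro t ht
      obtain ⟨l, -, i, rfl⟩ := mem_iUnion₂.1 ht
      exact (hb l i).2.trans_lt (hv4 l)
    · obtain ⟨i⟩ := hne 0
      obtain ⟨j⟩ := hne 1
      refine ⟨b 0 i, hmemT k 0 (by omega) i, b 1 j, hmemT k 1 (by omega) j, fun h => ?_⟩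
      have := hfar 0 1 (by norm_num) i j
      rw [h, disjoint_self] at this
      exact (nonempty_Icc.2 (b 1 j).lt.le).ne_empty this
  refine ⟨T, fun k l hkl => ?_, hTsys, fun k => ?_⟩
  · exact biUnion_subset_biUnion_left (Iic_subset_Iic.2 (by omega))
  · exact hf.le_dimH_survivors (hTsys k) (hs k) (hmemT k k (Nat.le_succ k)) (hinj k) (hκ k)
      (hsum k)

theorem corollaryB (f : ℝ → ℝ) (α C C₁ : ℝ)
    (hmaps : MapsTo f puncturedInterval (Icc (-1 / 2 : ℝ) (1 / 2)))
    (hC2 : ContDiffOn ℝ 2 f puncturedInterval)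
    (hf1_left : Tendsto f (𝓝[<] 0) (𝓝 (1 / 2)))
    (hf1_right : Tendsto f (𝓝[>] 0) (𝓝 (-1 / 2)))
    (hf2 : ∀ x ∈ puncturedInterval, √2 < derivWithin f puncturedInterval x)
    (hf3_left : Tendsto (derivWithin f puncturedInterval) (𝓝[<] 0) atTop)
    (hf3_right : Tendsto (derivWithin f puncturedInterval) (𝓝[>] 0) atTop)
    (hleft : f (-1 / 2) ≠ -1 / 2) (hright : f (1 / 2) ≠ 1 / 2)
    (hC : 1 < C) (hC₁ : 1 < C₁)
    (hderiv : ∀ x ∈ puncturedInterval,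
      1 / C ≤ derivWithin f puncturedInterval x / |x| ^ (α - 1) ∧
        derivWithin f puncturedInterval x / |x| ^ (α - 1) ≤ C)
    (hderiv2 : ∀ x ∈ puncturedInterval,
      |iteratedDerivWithin 2 f puncturedInterval x| / |x| ^ (α - 2) ≤ C₁) :
    ∃ K : ℕ → Set ℝ, (∀ k, IsRegularCantorSetFor f (K k)) ∧ Monotone K ∧
      Tendsto (fun k => dimH (K k)) atTop (𝓝 1) := by
  obtain ⟨lam, B, β, hf⟩ := exists_isLorenzMap hmaps hC2 hf1_left hf1_right hf2 hf3_left hf3_right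
    hC hC₁ hderiv hderiv2
  -- The exponents 1 - 1/(k + 2) start at 1/2, so all of them lie in (0, 1).
  obtain ⟨T, hTmono, hTsys, hTdim⟩ := hf.exists_branchSystems
    (s := fun k : ℕ => 1 - 1 / ((k : ℝ) + 1 + 1))
    (fun k => by
      rw [sub_pos, div_lt_one (by positivity)]
      have : (0 : ℝ) ≤ k := by positivity
      linarith)
    (fun k => by
      have : (0 : ℝ) < 1 / ((k : ℝ) + 1 + 1) := by positivity
      linarith)
  refine ⟨fun k => survivors (T k), fun k => hf.isRegularCantorSetFor_survivors (hTsys k),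
    fun k l hkl => survivors_mono (hTsys l).pairwiseDisjoint (hTmono hkl), ?_⟩
  have hlim : Tendsto (fun k : ℕ => ENNReal.ofReal (1 - 1 / ((k : ℝ) + 1 + 1))) atTop (𝓝 1) := by
    have h1 : Tendsto (fun k : ℕ => 1 / ((k : ℝ) + 1 + 1)) atTop (𝓝 0) := by
      have := (tendsto_one_div_add_atTop_nhds_zero_nat (𝕜 := ℝ)).comp (tendsto_add_atTop_nat 1)
      refine this.congr fun k => ?_
      simp
    have h2 := ENNReal.tendsto_ofReal (h1.const_sub 1)
    simpa using h2
  refine tendsto_of_tendsto_of_tendsto_of_le_of_le hlim tendsto_const_nhds hTdim fun k => ?_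
  calc dimH (survivors (T k)) ≤ dimH (univ : Set ℝ) := dimH_mono (subset_univ _)
    _ = 1 := Real.dimH_univ
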